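/- Let $\mathbb K$ be a field of characteristic $0$. DG-Lie algebras are over $\mathbb K$, $\mathbb Z$-graded, with differential of degree $+1$. For a DG-Lie algebra $\mathfrak g$, let $\operatorname{cone}(\mathrm{Id}_{\mathfrak g})=\mathfrak g\oplus\mathfrak g[1]$ be the DG-Lie algebra containing $\mathfrak g$ as a DG-Lie subalgebra, with $d(\flat x)=x-\flat dx$, $[\flat x,y]=\flat[x,y]$, $[\flat x,\flat y]=0$, where $\flat\colon\mathfrak g\to\mathfrak g[1]$ is the tautological map of degree $-1$. A *Cartan calculus* is a commutative square of DG-Lie algebras $$\begin{array}{ccc}\mathfrak g_{00}&\xrightarrow{\ h\ }&\mathfrak g_{10}\\ \downarrow&&\downarrow{\scriptstyle\chi}\\ \operatorname{cone}(\mathrm{Id}_{\mathfrak g_{00}})&\xrightarrow{\ c\ }&\mathfrak g_{11}\end{array}$$ with left vertical arrow the inclusion; its *Cartan homotopy* is the degree $-1$ map $\boldsymbol i=c\circ\flat\colon\mathfrak g_{00}\to\mathfrak g_{11}$. A *morphism of Cartan calculi* from $(\mathfrak g_{000},\mathfrak g_{100},\mathfrak g_{110},h_0,\chi_0,c_0)$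 to $(\mathfrak g_{001},\mathfrak g_{101},\mathfrak g_{111},h_1,\chi_1,c_1)$ consists of DG-Lie morphisms $\varphi\colon\mathfrak g_{000}\to\mathfrak g_{001}$, $\mathfrak g_{100}\to\mathfrak g_{101}$, $\mathfrak g_{110}\to\mathfrak g_{111}$ which, together with $\operatorname{cone}(\varphi)$, form a morphism of commutative squares; $\boldsymbol i_1$ denotes the Cartan homotopy of the target. Let $\Omega^\bullet(\Delta^1;V)=\mathbb K[t,dt]\otimes V$ and $\Omega^\bullet(\Delta^1\times\Delta^1;V)=\mathbb K[t_0,t_1,dt_0,dt_1]\otimes V$ denote polynomial forms. The Thom–Whitney model of the homotopy fiber of $f\colon\mathfrak a_0\to\mathfrak a_1$ is $$TW(f)=\{(\omega_0,\omega_1)\in\mathfrak a_0\times\Omega^\bullet(\Delta^1;\mathfrak a_1)\mid \omega_1|_{t=0}=0,\ \omega_1|_{t=1}=f(\omega_0)\}.$$ For a commutative square $\mathfrak a_{\bullet\bullet}$ with arrows $\mathfrak a_{00}\to\mathfrak a_{01}\to\mathfrak a_{11}$ and $\mathfrak a_{00}\to\mathfrak a_{10}\to\mathfrak a_{11}$,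 the Thom–Whitney model $TW^{[2]}(\mathfrak a_{\bullet\bullet})$ of the double homotopy fiber $hofib^{[2]}(\mathfrak a_{\bullet\bullet})$ is the DG-Lie algebra of quadruples $(\omega_{00},\omega_{10},\omega_{01},\omega_{11})\in\mathfrak a_{00}\times\Omega^\bullet(\Delta^1;\mathfrak a_{10})\times\Omega^\bullet(\Delta^1;\mathfrak a_{01})\times\Omega^\bullet(\Delta^1\times\Delta^1;\mathfrak a_{11})$ such that $\omega_{10}$ (a form in $t_0$), $\omega_{01}$ (a form in $t_1$) and $\omega_{11}$ vanish at $t_0=0$, at $t_1=0$, and at both $t_0=0$ and $t_1=0$, respectively, while, up to the maps of the square, $\omega_{10}|_{t_0=1}=\omega_{00}$, $\omega_{01}|_{t_1=1}=\omega_{00}$, $\omega_{11}|_{t_0=1}=\omega_{01}$, $\omega_{11}|_{t_1=1}=\omega_{10}$. **Proposition.** Given a morphism of Cartan calculi as above, suppose that $\varphi\colon\mathfrak g_{000}\to\mathfrak g_{001}$ is the inclusion of a DG-Lie subalgebra and that the square $\mathfrak g_{1\bullet\bullet}$, formed by $\mathfrak g_{100},\mathfrak g_{101},\mathfrak g_{110},\mathfrak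 g_{111}$, is a pullback of inclusions of DG-Lie algebras $\mathfrak g_{110}\hookrightarrow\mathfrak g_{111}\hookleftarrow\mathfrak g_{101}$. Then in the span of DG-Lie algebras $$TW(\mathfrak g_{000}\xrightarrow{\varphi}\mathfrak g_{001})\longleftarrow TW^{[2]}\left(\begin{array}{ccc}\mathfrak g_{000}&\to&\mathfrak g_{001}\\ \downarrow&&\downarrow\\ \operatorname{cone}(\mathrm{Id}_{\mathfrak g_{000}})&\to&\operatorname{cone}(\mathrm{Id}_{\mathfrak g_{001}})\end{array}\right)\longrightarrow TW^{[2]}(\mathfrak g_{1\bullet\bullet})$$ (left arrow: the projection $(\omega_{00},\omega_{10},\omega_{01},\omega_{11})\mapsto(\omega_{00},\omega_{01})$; right arrow: induced by $h_0,h_1,c_0,c_1$) the left arrow is a quasi-isomorphism, so that the span presents a morphism $hofib(\mathfrak g_{00\bullet})\to hofib^{[2]}(\mathfrak g_{1\bullet\bullet})$ in the homotopy category of DG-Lie algebras (the localization at quasi-isomorphisms). For every integer $n$: 1. $(\omega_0,\omega_1)\mapsto\int_{\Delta^1}\omega_1$ induces an isomorphism $H^n(hofib(\mathfrak g_{00\bullet}))\cong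 H^{n-1}(\mathfrak g_{001}/\mathfrak g_{000})$; 2. $(\omega_{00},\omega_{10},\omega_{01},\omega_{11})\mapsto\int_{\Delta^1\times\Delta^1}\omega_{11}$ induces an isomorphism $H^n(hofib^{[2]}(\mathfrak g_{1\bullet\bullet}))\cong H^{n-2}(\mathfrak g_{111}/(\mathfrak g_{110}+\mathfrak g_{101}))$, where $\int_{\Delta^1\times\Delta^1}$ is oriented by $\int_{\Delta^1\times\Delta^1}dt_1\,dt_0\otimes y=y$; 3. under these isomorphisms, the map $H^n(hofib(\mathfrak g_{00\bullet}))\to H^n(hofib^{[2]}(\mathfrak g_{1\bullet\bullet}))$ induced by the above morphism of the homotopy category is the well-defined linear map $$H^{n-1}(\mathfrak g_{001}/\mathfrak g_{000})\to H^{n-2}(\mathfrak g_{111}/(\mathfrak g_{110}+\mathfrak g_{101})),\qquad [x]\mapsto[\boldsymbol i_{1\tilde x}\bmod \mathfrak g_{110}+\mathfrak g_{101}],$$ where $\tilde x\in\mathfrak g_{001}$ is any representative of $[x]$. -/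

import Mathlib

universe u

open scoped TensorProduct Polynomial

/-! ## DG vector spaces and DG-Lie algebras -/

/-- A differential graded vector space over `K`: a family of vector spaces indexed by the integers,
with a differential of degree `+1`. -/
structure DGVect (K : Type u) [Field K] where
  X : ℤ → Type u
  [addCommGroup : ∀ n, AddCommGroup (X n)]
  [module : ∀ n, Module K (X n)]
  d : ∀ {i j : ℤ}, i + 1 = j → X i →ₗ[K] X j
  d_d : ∀ {i j k : ℤ} (hij : i + 1 = j) (hjk : j + 1 = k) (x : X i), d hjk (d hij x) = 0

attribute [instance] DGVect.addCommGroup DGVect.module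

namespace DGVect

variable {K : Type u} [Field K]

/-- The identity `V^i → V^j` for `i = j`. -/
def reindex (V : DGVect K) {i j : ℤ} (h : i = j) : V.X i →ₗ[K] V.X j := h ▸ LinearMap.id

@[simp] lemma reindex_rfl (V : DGVect K) {i : ℤ} (h : i = i) (x : V.X i) :
    V.reindex h x = x := rfl

/-- Cocycles of degree `n`. -/
def cocycles (V : DGVect K) (n : ℤ) : Submodule K (V.X n) := LinearMap.ker (V.d (rfl : n + 1 = n + 1))

/-- Coboundaries of degree `n`. -/
def coboundaries (V : DGVect K) (n : ℤ) : Submodule K (V.X n) :=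
  LinearMap.range (V.d (sub_add_cancel n 1))

/-- The cohomology `H^n(V)`: cocycles modulo coboundaries. -/
abbrev H (V : DGVect K) (n : ℤ) : Type u :=
  V.cocycles n ⧸ (V.coboundaries n).submoduleOf (V.cocycles n)

/-- `x` is a cocycle, and its cohomology class is `c`. -/
def Represents (V : DGVect K) {n : ℤ} (c : V.H n) (x : V.X n) : Prop :=
  ∃ hx : x ∈ V.cocycles n,
    ((V.coboundaries n).submoduleOf (V.cocycles n)).mkQ ⟨x, hx⟩ = c

/-- The quotient of a DG vector space by a DG subspace. -/
def quot (V : DGVect K) (S : ∀ n, Submodule K (V.X n))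
    (hS : ∀ {i j : ℤ} (h : i + 1 = j), S i ≤ (S j).comap (V.d h)) : DGVect K where
  X n := V.X n ⧸ S n
  d {i j} h := (S i).mapQ (S j) (V.d h) (hS h)
  d_d hij hjk x := by
    induction x using Submodule.Quotient.induction_on with
    | _ x => simp [V.d_d]

end DGVect

/-- A differential graded Lie algebra over `K`. The bracket is given on homogeneous elements; the
axioms are graded antisymmetry, the graded Leibniz rule and the graded Jacobi identity. -/
structure DGLA (K : Type u) [Field K] extends DGVect K where
  br : ∀ {p q r : ℤ}, p + q = r → X p →ₗ[K] X q →ₗ[K] X r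
  br_symm : ∀ {p q r : ℤ} (h : p + q = r) (h' : q + p = r) (x : X p) (y : X q),
    br h x y = -((p * q).negOnePow • br h' y x)
  d_br : ∀ {p q r p' q' r' : ℤ} (h : p + q = r) (hp : p + 1 = p') (hq : q + 1 = q')
    (hr : r + 1 = r') (h₁ : p' + q = r') (h₂ : p + q' = r') (x : X p) (y : X q),
    d hr (br h x y) = br h₁ (d hp x) y + p.negOnePow • br h₂ x (d hq y)
  jacobi : ∀ {p q r pq pr qr s : ℤ} (hpq : p + q = pq) (hpr : p + r = pr) (hqr : q + r = qr)
    (h₁ : p + qr = s) (h₂ : pq + r = s) (h₃ : q + pr = s) (x : X p) (y : X q) (z : X r),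
    br h₁ x (br hqr y z) = br h₂ (br hpq x y) z + (p * q).negOnePow • br h₃ y (br hpr x z)

namespace DGLA

variable {K : Type u} [Field K]

/-- A morphism of DG-Lie algebras. -/
@[ext]
structure Hom (A B : DGLA K) where
  f : ∀ n, A.X n →ₗ[K] B.X n
  comm_d : ∀ {i j : ℤ} (h : i + 1 = j) (x : A.X i), f j (A.d h x) = B.d h (f i x)
  comm_br : ∀ {p q r : ℤ} (h : p + q = r) (x : A.X p) (y : A.X q),
    f r (A.br h x y) = B.br h (f p x) (f q y)

instance : CategoryTheory.Category (DGLA K) where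
  Hom := Hom
  id A := ⟨fun _ => LinearMap.id, fun _ _ => rfl, fun _ _ _ => rfl⟩
  comp f g := ⟨fun n => g.f n ∘ₗ f.f n, fun h x => by simp [f.comm_d, g.comm_d],
    fun h x y => by simp [f.comm_br, g.comm_br]⟩

open CategoryTheory

/-- A morphism that is injective in every degree, i.e. the inclusion of a DG-Lie subalgebra. -/
def IsInclusion {A B : DGLA K} (f : A ⟶ B) : Prop := ∀ n, Function.Injective (f.f n)

@[simp] lemma id_f (A : DGLA K) (n : ℤ) : Hom.f (𝟙 A) n = LinearMap.id := rfl

@[simp] lemma comp_f {A B C : DGLA K} (f : A ⟶ B) (g : B ⟶ C) (n : ℤ) :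
    Hom.f (f ≫ g) n = g.f n ∘ₗ f.f n := rfl

lemma reindex_f {A B : DGLA K} (f : A ⟶ B) {i j : ℤ} (h : i = j) (x : A.X i) :
    f.f j (A.reindex h x) = B.reindex h (f.f i x) := by
  subst h; rfl

/-- The map induced by a morphism in cohomology. -/
def Hmap {A B : DGLA K} (f : A ⟶ B) (n : ℤ) : A.H n →ₗ[K] B.H n :=
  Submodule.mapQ _ _
    ((f.f n).restrict (p := A.cocycles n) (q := B.cocycles n) (fun x hx => by
      have hx' : A.d rfl x = 0 := hx
      show B.d rfl (f.f n x) = 0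
      rw [← f.comm_d, hx', map_zero]))
    (by
      rintro ⟨x, hx⟩ ⟨y, hy⟩
      exact ⟨f.f _ y, by rw [← f.comm_d, hy]; rfl⟩)

/-- Cohomology in degree `n`, as a functor. -/
def cohomology (K : Type u) [Field K] (n : ℤ) : DGLA K ⥤ ModuleCat.{u} K where
  obj A := ModuleCat.of K (A.H n)
  map f := ModuleCat.ofHom (Hmap f n)
  map_id A := by
    ext x
    rfl
  map_comp f g := by
    ext x
    rfl

/-- The quasi-isomorphisms of DG-Lie algebras. -/
def quasiIso (K : Type u) [Field K] : MorphismProperty (DGLA K) :=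
  fun _ _ f => ∀ n, Function.Bijective (Hmap f n)

lemma quasiIso_inverted (n : ℤ) : (quasiIso K).IsInvertedBy (cohomology K n) := by
  intro A B f hf
  exact (ConcreteCategory.isIso_iff_bijective ((cohomology K n).map f)).2 (hf n)

/-- The homotopy category of DG-Lie algebras: the quasi-isomorphisms are formally inverted. -/
abbrev Ho (K : Type u) [Field K] := (quasiIso K).Localization

/-- A DG-Lie algebra as an object of the homotopy category. -/
abbrev toHo (K : Type u) [Field K] : DGLA K ⥤ Ho K := (quasiIso K).Q

/-- The map induced in cohomology by a morphism of the homotopy category. -/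
noncomputable def hoHmap {A B : DGLA K} (F : (toHo K).obj A ⟶ (toHo K).obj B) (n : ℤ) :
    A.H n →ₗ[K] B.H n :=
  ((Localization.fac (cohomology K n) (quasiIso_inverted n) (toHo K)).inv.app A ≫
    (Localization.lift (cohomology K n) (quasiIso_inverted n) (toHo K)).map F ≫
    (Localization.fac (cohomology K n) (quasiIso_inverted n) (toHo K)).hom.app B).hom

/-- The morphism `A ⟶ B` of the homotopy category presented by a span `A ⟵ S ⟶ B` whose left leg is
a quasi-isomorphism. -/
noncomputable def spanHo {S A B : DGLA K} (l : S ⟶ A) (hl : quasiIso K l) (r : S ⟶ B) :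
    (toHo K).obj A ⟶ (toHo K).obj B :=
  (Localization.isoOfHom (toHo K) (quasiIso K) l hl).inv ≫ (toHo K).map r

/-! ## Constructions of DG-Lie algebras -/

lemma reindex_br_left (g : DGLA K) {p p' q r : ℤ} (hp : p = p') (h : p' + q = r) (h' : p + q = r)
    (x : g.X p) (y : g.X q) : g.br h (g.reindex hp x) y = g.br h' x y := by
  subst hp; rfl

lemma reindex_br_right (g : DGLA K) {p q q' r : ℤ} (hq : q = q') (h : p + q' = r) (h' : p + q = r)
    (x : g.X p) (y : g.X q) : g.br h x (g.reindex hq y) = g.br h' x y := by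
  subst hq; rfl

lemma reindex_br (g : DGLA K) {p q r r' : ℤ} (hr : r = r') (h : p + q = r) (h' : p + q = r')
    (x : g.X p) (y : g.X q) : g.reindex hr (g.br h x y) = g.br h' x y := by
  subst hr; rfl

lemma reindex_d (g : DGLA K) {i j j' : ℤ} (hj : j = j') (h : i + 1 = j) (h' : i + 1 = j')
    (x : g.X i) : g.reindex hj (g.d h x) = g.d h' x := by
  subst hj; rfl

lemma d_reindex (g : DGLA K) {i i' j : ℤ} (hi : i = i') (h : i' + 1 = j) (h' : i + 1 = j)
    (x : g.X i) : g.d h (g.reindex hi x) = g.d h' x := by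
  subst hi; rfl

lemma sign_smul_comm {M : Type*} [AddCommGroup M] [Module K M] (e : ℤˣ) (c : K) (x : M) :
    e • c • x = c • e • x := by
  rcases Int.units_eq_one_or e with rfl | rfl <;> simp

lemma map_sign {M N : Type*} [AddCommGroup M] [AddCommGroup N] [Module K M] [Module K N]
    (f : M →ₗ[K] N) (e : ℤˣ) (x : M) : f (e • x) = e • f x := by
  rcases Int.units_eq_one_or e with rfl | rfl <;> simp

/-- The product of two DG-Lie algebras. -/
def prod (A B : DGLA K) : DGLA K where
  X n := A.X n × B.X n
  d h := (A.d h).prodMap (B.d h)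
  d_d hij hjk x := by simp [A.d_d, B.d_d]
  br h := LinearMap.mk₂ K (fun x y => (A.br h x.1 y.1, B.br h x.2 y.2))
    (by intros; simp) (by intros; simp) (by intros; simp) (by intros; simp)
  br_symm h h' x y := Prod.ext (A.br_symm h h' _ _) (B.br_symm h h' _ _)
  d_br h hp hq hr h₁ h₂ x y :=
    Prod.ext (A.d_br h hp hq hr h₁ h₂ _ _) (B.d_br h hp hq hr h₁ h₂ _ _)
  jacobi hpq hpr hqr h₁ h₂ h₃ x y z :=
    Prod.ext (A.jacobi hpq hpr hqr h₁ h₂ h₃ _ _ _) (B.jacobi hpq hpr hqr h₁ h₂ h₃ _ _ _)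

/-- The DG-Lie subalgebra with underlying subspaces `S n`. -/
def sub (A : DGLA K) (S : ∀ n, Submodule K (A.X n))
    (hd : ∀ {i j : ℤ} (h : i + 1 = j), ∀ x ∈ S i, A.d h x ∈ S j)
    (hbr : ∀ {p q r : ℤ} (h : p + q = r), ∀ x ∈ S p, ∀ y ∈ S q, A.br h x y ∈ S r) : DGLA K where
  X n := S n
  d h := (A.d h).restrict (hd h)
  d_d hij hjk x := Subtype.ext (A.d_d hij hjk _)
  br h := LinearMap.mk₂ K (fun x y => ⟨A.br h x.1 y.1, hbr h _ x.2 _ y.2⟩)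
    (by intros; ext; simp) (by intros; ext; simp) (by intros; ext; simp) (by intros; ext; simp)
  br_symm {p q r} h h' x y := Subtype.ext (by
    rcases Int.units_eq_one_or (p * q).negOnePow with e | e <;>
      simpa [e] using A.br_symm h h' x.1 y.1)
  d_br {p _ _ _ _ _} h hp hq hr h₁ h₂ x y := Subtype.ext (by
    rcases Int.units_eq_one_or p.negOnePow with e | e <;>
      simpa [e] using A.d_br h hp hq hr h₁ h₂ x.1 y.1)
  jacobi {p q _ _ _ _ _} hpq hpr hqr h₁ h₂ h₃ x y z := Subtype.ext (by
    rcases Int.units_eq_one_or (p * q).negOnePow with e | e <;>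
      simpa [e] using A.jacobi hpq hpr hqr h₁ h₂ h₃ x.1 y.1 z.1)

/-! ### The mapping cone of the identity

A pair `(x, y)` with `x ∈ g^n` and `y ∈ g^(n+1)` stands for the element `x + ♭y` of degree `n` of
`cone(Id_g) = g ⊕ g[1]`. -/

/-- The differential `d(x + ♭y) = (dx + y) - ♭dy` of the cone. -/
def coneD (g : DGLA K) {i j : ℤ} (h : i + 1 = j) :
    g.X i × g.X (i + 1) →ₗ[K] g.X j × g.X (j + 1) :=
  (g.d h ∘ₗ LinearMap.fst K _ _ + g.reindex h ∘ₗ LinearMap.snd K _ _).prod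
    (-(g.d (congrArg (· + 1) h) ∘ₗ LinearMap.snd K _ _))

/-- The bracket `[x + ♭y, x' + ♭y'] = [x, x'] + ♭([y, x'] + (-1)^|x| [x, y'])` of the cone; that is,
`[♭y, x'] = ♭[y, x']` and `[♭y, ♭y'] = 0`. -/
def coneBr (g : DGLA K) {p q r : ℤ} (h : p + q = r) :
    g.X p × g.X (p + 1) →ₗ[K] g.X q × g.X (q + 1) →ₗ[K] g.X r × g.X (r + 1) :=
  LinearMap.mk₂ K (fun x y => (g.br h x.1 y.1,
      g.br (by omega : p + 1 + q = r + 1) x.2 y.1 +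
        p.negOnePow • g.br (by omega : p + (q + 1) = r + 1) x.1 y.2))
    (by rintro ⟨a, b⟩ ⟨a', b'⟩ ⟨c, d⟩; ext <;> simp; abel)
    (by rintro t ⟨a, b⟩ ⟨c, d⟩; ext <;> simp [sign_smul_comm])
    (by rintro ⟨a, b⟩ ⟨a', b'⟩ ⟨c, d⟩; ext <;> simp; abel)
    (by rintro t ⟨a, b⟩ ⟨c, d⟩; ext <;> simp [sign_smul_comm])

@[simp] lemma coneD_apply (g : DGLA K) {i j : ℤ} (h : i + 1 = j) (x : g.X i × g.X (i + 1)) :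
    g.coneD h x = (g.d h x.1 + g.reindex h x.2, -g.d (congrArg (· + 1) h) x.2) := rfl

@[simp] lemma coneBr_apply (g : DGLA K) {p q r : ℤ} (h : p + q = r)
    (x : g.X p × g.X (p + 1)) (y : g.X q × g.X (q + 1)) :
    g.coneBr h x y = (g.br h x.1 y.1,
      g.br (by omega : p + 1 + q = r + 1) x.2 y.1 +
        p.negOnePow • g.br (by omega : p + (q + 1) = r + 1) x.1 y.2) := rfl

lemma coneD_coneD (g : DGLA K) {i j k : ℤ} (hij : i + 1 = j) (hjk : j + 1 = k)
    (x : g.X i × g.X (i + 1)) : g.coneD hjk (g.coneD hij x) = 0 := by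
  subst hij hjk
  ext <;> simp [g.d_d]

lemma coneBr_symm (g : DGLA K) {p q r : ℤ} (h : p + q = r) (h' : q + p = r)
    (x : g.X p × g.X (p + 1)) (y : g.X q × g.X (q + 1)) :
    g.coneBr h x y = -((p * q).negOnePow • g.coneBr h' y x) := by
  obtain ⟨x', y'⟩ := y
  obtain ⟨x, y⟩ := x
  have e₀ := g.br_symm h h' x x'
  have e₁ := g.br_symm (by omega : p + 1 + q = r + 1) (by omega : q + (p + 1) = r + 1) y x'
  have e₂ := g.br_symm (by omega : p + (q + 1) = r + 1) (by omega : q + 1 + p = r + 1) x y'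
  simp only [add_mul, mul_add, Int.negOnePow_add, one_mul, mul_one] at e₁ e₂
  refine Prod.ext ?_ ?_
  · exact e₀
  · show g.br _ y x' + p.negOnePow • g.br _ x y' =
      -((p * q).negOnePow • (g.br _ y' x + q.negOnePow • g.br _ x' y))
    rw [e₁, e₂]
    rcases Int.units_eq_one_or p.negOnePow with ep | ep <;>
    rcases Int.units_eq_one_or q.negOnePow with eq | eq <;>
    rcases Int.units_eq_one_or (p * q).negOnePow with epq | epq <;>
    simp [ep, eq, epq]

lemma coneD_coneBr (g : DGLA K) {p q r p' q' r' : ℤ} (h : p + q = r) (hp : p + 1 = p')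
    (hq : q + 1 = q') (hr : r + 1 = r') (h₁ : p' + q = r') (h₂ : p + q' = r')
    (x : g.X p × g.X (p + 1)) (y : g.X q × g.X (q + 1)) :
    g.coneD hr (g.coneBr h x y) =
      g.coneBr h₁ (g.coneD hp x) y + p.negOnePow • g.coneBr h₂ x (g.coneD hq y) := by
  obtain ⟨x', y'⟩ := y
  obtain ⟨x, y⟩ := x
  subst h hp hq hr
  have e₁ := g.d_br (by omega : p + q = p + q) rfl rfl rfl h₁ h₂ x x'
  have e₂ := g.d_br (by omega : p + 1 + q = p + q + 1) rfl rfl rfl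
    (by omega) (by omega) y x'
  have e₃ := g.d_br (by omega : p + (q + 1) = p + q + 1) rfl rfl rfl
    (by omega) (by omega) x y'
  simp only [coneBr_apply, coneD_apply, map_add, map_sign, e₁, e₂, e₃, Int.negOnePow_succ,
    DGVect.reindex_rfl, LinearMap.add_apply, map_neg, LinearMap.neg_apply]
  rcases Int.units_eq_one_or p.negOnePow with ep | ep <;>
  · ext <;> simp [ep] <;> abel

lemma coneBr_jacobi (g : DGLA K) {p q r pq pr qr s : ℤ} (hpq : p + q = pq) (hpr : p + r = pr)
    (hqr : q + r = qr) (h₁ : p + qr = s) (h₂ : pq + r = s) (h₃ : q + pr = s)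
    (x : g.X p × g.X (p + 1)) (y : g.X q × g.X (q + 1)) (z : g.X r × g.X (r + 1)) :
    g.coneBr h₁ x (g.coneBr hqr y z) = g.coneBr h₂ (g.coneBr hpq x y) z +
      (p * q).negOnePow • g.coneBr h₃ y (g.coneBr hpr x z) := by
  obtain ⟨x, a⟩ := x
  obtain ⟨y, b⟩ := y
  obtain ⟨z, c⟩ := z
  subst hpq hpr hqr
  have e₀ := g.jacobi rfl rfl rfl h₁ h₂ h₃ x y z
  have e₁ := g.jacobi (s := s + 1) (by omega : p + 1 + q = p + q + 1)
    (by omega : p + 1 + r = p + r + 1)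
    (by omega : q + r = q + r) (by omega) (by omega) (by omega) a y z
  have e₂ := g.jacobi (s := s + 1) (by omega : p + (q + 1) = p + q + 1)
    (by omega : p + r = p + r)
    (by omega : q + 1 + r = q + r + 1) (by omega) (by omega) (by omega) x b z
  have e₃ := g.jacobi (s := s + 1) (by omega : p + q = p + q)
    (by omega : p + (r + 1) = p + r + 1)
    (by omega : q + (r + 1) = q + r + 1) (by omega) (by omega) (by omega) x y c
  simp only [add_mul, mul_add, Int.negOnePow_add, one_mul, mul_one] at e₁ e₂
  simp only [coneBr_apply, map_add, map_sign, LinearMap.add_apply, LinearMap.smul_apply,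
    e₀, e₁, e₂, e₃, Int.negOnePow_add]
  rcases Int.units_eq_one_or p.negOnePow with ep | ep <;>
  rcases Int.units_eq_one_or q.negOnePow with eq | eq <;>
  rcases Int.units_eq_one_or (p * q).negOnePow with epq | epq <;>
  · ext <;> (simp [ep, eq, epq]; try abel)

/-- The DG-Lie algebra `cone(Id_g)`. -/
def cone (g : DGLA K) : DGLA K where
  X n := g.X n × g.X (n + 1)
  d h := g.coneD h
  d_d := g.coneD_coneD
  br h := g.coneBr h
  br_symm := g.coneBr_symm
  d_br := g.coneD_coneBr
  jacobi := g.coneBr_jacobi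

/-- The inclusion `g ⟶ cone(Id_g)`. -/
def coneIncl (g : DGLA K) : g ⟶ cone g where
  f n := LinearMap.inl K (g.X n) (g.X (n + 1))
  comm_d {i j} h x := by
    show ((g.d h x, 0) : g.X j × g.X (j + 1)) = g.coneD h (x, 0)
    simp
  comm_br {p q r} h x y := by
    show ((g.br h x y, 0) : g.X r × g.X (r + 1)) = g.coneBr h (x, 0) (y, 0)
    simp

/-- The embedding `♭ : g ⟶ g[1] ⊆ cone(Id_g)`, of degree `-1`. -/
def flat (g : DGLA K) {m k : ℤ} (h : k + 1 = m) : g.X m →ₗ[K] (cone g).X k :=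
  LinearMap.inr K (g.X k) (g.X (k + 1)) ∘ₗ g.reindex h.symm

/-- The functoriality of the cone: `cone(φ)(x + ♭y) = φ(x) + ♭φ(y)`. -/
def coneMap {A B : DGLA K} (φ : A ⟶ B) : cone A ⟶ cone B where
  f n := (φ.f n).prodMap (φ.f (n + 1))
  comm_d {i j} h := by
    rintro ⟨x, y⟩
    show (φ.f j (A.d h x + A.reindex h y), φ.f (j + 1) (-A.d _ y)) =
      B.coneD h (φ.f i x, φ.f (i + 1) y)
    simp [φ.comm_d, reindex_f]
  comm_br {p q r} h := by
    rintro ⟨x, y⟩ ⟨x', y'⟩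
    show (φ.f r (A.br h x x'),
        φ.f (r + 1) (A.br _ y x' + p.negOnePow • A.br _ x y')) =
      B.coneBr h (φ.f p x, φ.f (p + 1) y) (φ.f q x', φ.f (q + 1) y')
    simp [φ.comm_br]

/-! ### Polynomial differential forms on the interval

`Ω(Δ¹; g) = Ω(Δ¹) ⊗ g`, where `Ω(Δ¹) = K[t] ⊕ dt K[t]` is the algebra of polynomial forms in the
coordinate `t = t₁` of `Δ¹`. A pair `(a, b)`, with `a ∈ K[t] ⊗ g^n` and `b ∈ K[t] ⊗ g^(n-1)`, stands
for the form `a + dt b` of degree `n`. The two face maps of the simplex are the evaluations at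
`t = 0` and `t = 1`. -/

/-- The differential of `g`, extended `K[t]`-linearly. -/
noncomputable def polyD (g : DGLA K) {i j : ℤ} (h : i + 1 = j) :
    K[X] ⊗[K] g.X i →ₗ[K] K[X] ⊗[K] g.X j := (g.d h).lTensor K[X]

/-- The bracket of `g`, extended `K[t]`-bilinearly. -/
noncomputable def polyBr (g : DGLA K) {p q r : ℤ} (h : p + q = r) :
    K[X] ⊗[K] g.X p →ₗ[K] K[X] ⊗[K] g.X q →ₗ[K] K[X] ⊗[K] g.X r :=
  TensorProduct.map₂ (LinearMap.mul K K[X]) (g.br h)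

@[simp] lemma polyBr_tmul (g : DGLA K) {p q r : ℤ} (h : p + q = r) (f f' : K[X]) (x : g.X p)
    (y : g.X q) : g.polyBr h (f ⊗ₜ x) (f' ⊗ₜ y) = (f * f') ⊗ₜ g.br h x y := rfl

@[simp] lemma polyD_tmul (g : DGLA K) {i j : ℤ} (h : i + 1 = j) (f : K[X]) (x : g.X i) :
    g.polyD h (f ⊗ₜ x) = f ⊗ₜ g.d h x := rfl

lemma tmul_sign {M : Type*} [AddCommGroup M] [Module K M] (f : K[X]) (e : ℤˣ) (x : M) :
    f ⊗ₜ[K] (e • x) = e • (f ⊗ₜ[K] x) := by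
  rcases Int.units_eq_one_or e with rfl | rfl <;> simp [TensorProduct.tmul_neg]

/-- The DG-Lie algebra `K[t] ⊗ g`. -/
noncomputable def poly (g : DGLA K) : DGLA K where
  X n := K[X] ⊗[K] g.X n
  d h := g.polyD h
  d_d hij hjk x := by
    induction x with
    | zero => simp
    | tmul f x => simp [g.d_d]
    | add x y hx hy => simp [hx, hy]
  br h := g.polyBr h
  br_symm {p q _} h h' x y := by
    induction x with
    | zero => simp
    | add x₁ x₂ hx₁ hx₂ => simp only [map_add, LinearMap.add_apply, smul_add, neg_add, hx₁, hx₂]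
    | tmul f x =>
      induction y with
      | zero => simp
      | add y₁ y₂ hy₁ hy₂ => simp only [map_add, LinearMap.add_apply, smul_add, neg_add, hy₁, hy₂]
      | tmul f' y =>
        rw [polyBr_tmul, polyBr_tmul, g.br_symm h h' x y, TensorProduct.tmul_neg, tmul_sign,
          mul_comm f f']
  d_br h hp hq hr h₁ h₂ x y := by
    induction x with
    | zero => simp
    | add x₁ x₂ hx₁ hx₂ => simp only [map_add, LinearMap.add_apply, smul_add, hx₁, hx₂]; abel
    | tmul f x =>
      induction y with
      | zero => simp
      | add y₁ y₂ hy₁ hy₂ => simp only [map_add, smul_add, hy₁, hy₂]; abel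
      | tmul f' y =>
        simp only [polyBr_tmul, polyD_tmul]
        rw [g.d_br h hp hq hr h₁ h₂ x y, TensorProduct.tmul_add, tmul_sign]
  jacobi hpq hpr hqr h₁ h₂ h₃ x y z := by
    induction x with
    | zero => simp
    | add x₁ x₂ hx₁ hx₂ => simp only [map_add, LinearMap.add_apply, smul_add, hx₁, hx₂]; abel
    | tmul f x =>
      induction y with
      | zero => simp
      | add y₁ y₂ hy₁ hy₂ => simp only [map_add, LinearMap.add_apply, smul_add, hy₁, hy₂]; abel
      | tmul f' y =>
        induction z with
        | zero => simp
        | add z₁ z₂ hz₁ hz₂ => simp only [map_add, smul_add, hz₁, hz₂]; abel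
        | tmul f'' z =>
          simp only [polyBr_tmul]
          rw [g.jacobi hpq hpr hqr h₁ h₂ h₃ x y z, TensorProduct.tmul_add, tmul_sign,
            mul_assoc, mul_left_comm f' f f'']

/-- The derivative `∂/∂t` on `K[t] ⊗ V`. -/
noncomputable def derivT (V : Type u) [AddCommGroup V] [Module K V] :
    K[X] ⊗[K] V →ₗ[K] K[X] ⊗[K] V := Polynomial.derivative.rTensor V

lemma derivT_polyD (g : DGLA K) {i j : ℤ} (h : i + 1 = j) (x : K[X] ⊗[K] g.X i) :
    derivT (g.X j) (g.polyD h x) = g.polyD h (derivT (g.X i) x) := by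
  induction x with
  | zero => simp
  | tmul f x => rfl
  | add x y hx hy => simp only [map_add, hx, hy]

lemma derivT_polyBr (g : DGLA K) {p q r : ℤ} (h : p + q = r) (x : K[X] ⊗[K] g.X p)
    (y : K[X] ⊗[K] g.X q) :
    derivT (g.X r) (g.polyBr h x y) =
      g.polyBr h (derivT (g.X p) x) y + g.polyBr h x (derivT (g.X q) y) := by
  induction x with
  | zero => simp
  | add x₁ x₂ h₁ h₂ => simp only [map_add, LinearMap.add_apply, h₁, h₂]; abel
  | tmul f x =>
    induction y with
    | zero => simp
    | add y₁ y₂ h₁ h₂ => simp only [map_add, h₁, h₂]; abel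
    | tmul f' y =>
      show Polynomial.derivative (f * f') ⊗ₜ[K] g.br h x y =
        (Polynomial.derivative f * f') ⊗ₜ[K] g.br h x y +
          (f * Polynomial.derivative f') ⊗ₜ[K] g.br h x y
      rw [Polynomial.derivative_mul, TensorProduct.add_tmul]

/-- The derivative `∂/∂t` on `K[t] ⊗ g^n`. -/
noncomputable def polyDer (g : DGLA K) (n : ℤ) : (poly g).X n →ₗ[K] (poly g).X n :=
  derivT (g.X n)

lemma polyDer_d (g : DGLA K) {i j : ℤ} (h : i + 1 = j) (x : (poly g).X i) :
    g.polyDer j ((poly g).d h x) = (poly g).d h (g.polyDer i x) := derivT_polyD g h x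

lemma polyDer_br (g : DGLA K) {p q r : ℤ} (h : p + q = r) (x : (poly g).X p) (y : (poly g).X q) :
    g.polyDer r ((poly g).br h x y) =
      (poly g).br h (g.polyDer p x) y + (poly g).br h x (g.polyDer q y) := derivT_polyBr g h x y

/-- The differential `d(a + dt b) = da + dt (∂a/∂t - db)`. -/
noncomputable def formsD (g : DGLA K) {i j : ℤ} (h : i + 1 = j) :
    (poly g).X i × (poly g).X (i - 1) →ₗ[K] (poly g).X j × (poly g).X (j - 1) :=
  ((poly g).d h ∘ₗ LinearMap.fst K _ _).prod
    ((poly g).reindex (by omega : i = j - 1) ∘ₗ g.polyDer i ∘ₗ LinearMap.fst K _ _ -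
      (poly g).d (by omega : i - 1 + 1 = j - 1) ∘ₗ LinearMap.snd K _ _)

/-- The bracket `[a + dt b, a' + dt b'] = [a, a'] + dt ([b, a'] + (-1)^|a| [a, b'])`. -/
noncomputable def formsBr (g : DGLA K) {p q r : ℤ} (h : p + q = r) :
    (poly g).X p × (poly g).X (p - 1) →ₗ[K] (poly g).X q × (poly g).X (q - 1) →ₗ[K]
      (poly g).X r × (poly g).X (r - 1) :=
  LinearMap.mk₂ K (fun x y => ((poly g).br h x.1 y.1,
      (poly g).br (by omega : p - 1 + q = r - 1) x.2 y.1 +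
        p.negOnePow • (poly g).br (by omega : p + (q - 1) = r - 1) x.1 y.2))
    (by rintro ⟨a, b⟩ ⟨a', b'⟩ ⟨c, d⟩; refine Prod.ext ?_ ?_ <;> simp; abel)
    (by rintro t ⟨a, b⟩ ⟨c, d⟩; refine Prod.ext ?_ ?_ <;> simp [sign_smul_comm])
    (by rintro ⟨a, b⟩ ⟨a', b'⟩ ⟨c, d⟩; refine Prod.ext ?_ ?_ <;> simp; abel)
    (by rintro t ⟨a, b⟩ ⟨c, d⟩; refine Prod.ext ?_ ?_ <;> simp [sign_smul_comm])

@[simp] lemma formsD_apply (g : DGLA K) {i j : ℤ} (h : i + 1 = j)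
    (x : (poly g).X i × (poly g).X (i - 1)) :
    g.formsD h x = ((poly g).d h x.1,
      (poly g).reindex (by omega : i = j - 1) (g.polyDer i x.1) -
        (poly g).d (by omega : i - 1 + 1 = j - 1) x.2) := rfl

@[simp] lemma formsBr_apply (g : DGLA K) {p q r : ℤ} (h : p + q = r)
    (x : (poly g).X p × (poly g).X (p - 1)) (y : (poly g).X q × (poly g).X (q - 1)) :
    g.formsBr h x y = ((poly g).br h x.1 y.1,
      (poly g).br (by omega : p - 1 + q = r - 1) x.2 y.1 +
        p.negOnePow • (poly g).br (by omega : p + (q - 1) = r - 1) x.1 y.2) := rfl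

lemma formsD_formsD (g : DGLA K) {i j k : ℤ} (hij : i + 1 = j) (hjk : j + 1 = k)
    (x : (poly g).X i × (poly g).X (i - 1)) : g.formsD hjk (g.formsD hij x) = 0 := by
  refine Prod.ext ?_ ?_
  · simp [(poly g).d_d]
  · simp only [formsD_apply, map_sub, (poly g).d_d, polyDer_d, sub_zero]
    rw [reindex_d _ _ hij (by omega : i + 1 = k - 1),
      d_reindex _ _ (by omega : j - 1 + 1 = k - 1) (by omega : i + 1 = k - 1), sub_self]
    rfl

lemma formsBr_symm (g : DGLA K) {p q r : ℤ} (h : p + q = r) (h' : q + p = r)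
    (x : (poly g).X p × (poly g).X (p - 1)) (y : (poly g).X q × (poly g).X (q - 1)) :
    g.formsBr h x y = -((p * q).negOnePow • g.formsBr h' y x) := by
  obtain ⟨x', y'⟩ := y
  obtain ⟨x, y⟩ := x
  have e₀ := (poly g).br_symm h h' x x'
  have e₁ := (poly g).br_symm (by omega : p - 1 + q = r - 1) (by omega : q + (p - 1) = r - 1) y x'
  have e₂ := (poly g).br_symm (by omega : p + (q - 1) = r - 1) (by omega : q - 1 + p = r - 1) x y'
  simp only [sub_mul, mul_sub, Int.negOnePow_sub, one_mul, mul_one] at e₁ e₂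
  refine Prod.ext ?_ ?_
  · exact e₀
  · show (poly g).br _ y x' + p.negOnePow • (poly g).br _ x y' =
      -((p * q).negOnePow • ((poly g).br _ y' x + q.negOnePow • (poly g).br _ x' y))
    rw [e₁, e₂]
    rcases Int.units_eq_one_or p.negOnePow with ep | ep <;>
    rcases Int.units_eq_one_or q.negOnePow with eq | eq <;>
    rcases Int.units_eq_one_or (p * q).negOnePow with epq | epq <;>
    simp [ep, eq, epq]

lemma formsD_formsBr (g : DGLA K) {p q r p' q' r' : ℤ} (h : p + q = r) (hp : p + 1 = p')
    (hq : q + 1 = q') (hr : r + 1 = r') (h₁ : p' + q = r') (h₂ : p + q' = r')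
    (x : (poly g).X p × (poly g).X (p - 1)) (y : (poly g).X q × (poly g).X (q - 1)) :
    g.formsD hr (g.formsBr h x y) =
      g.formsBr h₁ (g.formsD hp x) y + p.negOnePow • g.formsBr h₂ x (g.formsD hq y) := by
  obtain ⟨x', y'⟩ := y
  obtain ⟨x, y⟩ := x
  have e₁ := (poly g).d_br h hp hq hr h₁ h₂ x x'
  have e₂ := (poly g).d_br (by omega : p - 1 + q = r - 1) (by omega : p - 1 + 1 = p' - 1) hq
    (by omega : r - 1 + 1 = r' - 1) (by omega) (by omega) y x'
  have e₃ := (poly g).d_br (by omega : p + (q - 1) = r - 1) hp (by omega : q - 1 + 1 = q' - 1)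
    (by omega : r - 1 + 1 = r' - 1) (by omega) (by omega) x y'
  refine Prod.ext e₁ ?_
  show (poly g).reindex _ (g.polyDer r ((poly g).br h x x')) -
      (poly g).d _ ((poly g).br _ y x' + p.negOnePow • (poly g).br _ x y') =
    ((poly g).br _ ((poly g).reindex _ (g.polyDer p x) - (poly g).d _ y) x' +
      p'.negOnePow • (poly g).br _ ((poly g).d hp x) y') +
    p.negOnePow • ((poly g).br _ y ((poly g).d hq x') +
      p.negOnePow • (poly g).br _ x ((poly g).reindex _ (g.polyDer q x') - (poly g).d _ y'))
  rw [polyDer_br, map_add, map_add, map_sign, e₂, e₃, map_sub, map_sub, LinearMap.sub_apply,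
    reindex_br _ _ h (by omega : p + q = r' - 1), reindex_br _ _ h (by omega : p + q = r' - 1),
    reindex_br_left _ _ (by omega : p' - 1 + q = r' - 1) (by omega : p + q = r' - 1),
    reindex_br_right _ _ (by omega : p + (q' - 1) = r' - 1) (by omega : p + q = r' - 1)]
  subst hp
  simp only [Int.negOnePow_succ, Int.negOnePow_sub]
  rcases Int.units_eq_one_or p.negOnePow with ep | ep <;>
  · simp [ep]; abel

lemma formsBr_jacobi (g : DGLA K) {p q r pq pr qr s : ℤ} (hpq : p + q = pq) (hpr : p + r = pr)
    (hqr : q + r = qr) (h₁ : p + qr = s) (h₂ : pq + r = s) (h₃ : q + pr = s)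
    (x : (poly g).X p × (poly g).X (p - 1)) (y : (poly g).X q × (poly g).X (q - 1))
    (z : (poly g).X r × (poly g).X (r - 1)) :
    g.formsBr h₁ x (g.formsBr hqr y z) = g.formsBr h₂ (g.formsBr hpq x y) z +
      (p * q).negOnePow • g.formsBr h₃ y (g.formsBr hpr x z) := by
  obtain ⟨x, a⟩ := x
  obtain ⟨y, b⟩ := y
  obtain ⟨z, c⟩ := z
  subst hpq hpr hqr
  have e₀ := (poly g).jacobi rfl rfl rfl h₁ h₂ h₃ x y z
  have e₁ := (poly g).jacobi (s := s - 1) (by omega : p - 1 + q = p + q - 1)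
    (by omega : p - 1 + r = p + r - 1)
    (by omega : q + r = q + r) (by omega) (by omega) (by omega) a y z
  have e₂ := (poly g).jacobi (s := s - 1) (by omega : p + (q - 1) = p + q - 1)
    (by omega : p + r = p + r)
    (by omega : q - 1 + r = q + r - 1) (by omega) (by omega) (by omega) x b z
  have e₃ := (poly g).jacobi (s := s - 1) (by omega : p + q = p + q)
    (by omega : p + (r - 1) = p + r - 1)
    (by omega : q + (r - 1) = q + r - 1) (by omega) (by omega) (by omega) x y c
  simp only [sub_mul, mul_sub, Int.negOnePow_sub, one_mul, mul_one] at e₁ e₂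
  refine Prod.ext e₀ ?_
  simp only [formsBr_apply, map_add, map_sign, LinearMap.add_apply, LinearMap.smul_apply,
    e₁, e₂, e₃, Int.negOnePow_add, Prod.snd_add, Prod.smul_snd]
  rcases Int.units_eq_one_or p.negOnePow with ep | ep <;>
  rcases Int.units_eq_one_or q.negOnePow with eq | eq <;>
  rcases Int.units_eq_one_or (p * q).negOnePow with epq | epq <;>
  · simp [ep, eq, epq]; try abel

/-- The DG-Lie algebra `Ω(Δ¹; g) = Ω(Δ¹) ⊗ g`. -/
noncomputable def forms (g : DGLA K) : DGLA K where
  X n := (poly g).X n × (poly g).X (n - 1)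
  d h := g.formsD h
  d_d := g.formsD_formsD
  br h := g.formsBr h
  br_symm := g.formsBr_symm
  d_br := g.formsD_formsBr
  jacobi := g.formsBr_jacobi

/-- The functoriality of `K[t] ⊗ g`. -/
noncomputable def polyMap {A B : DGLA K} (φ : A ⟶ B) : poly A ⟶ poly B where
  f n := (φ.f n).lTensor K[X]
  comm_d {i j} h x := by
    have key : ∀ x : K[X] ⊗[K] A.X i,
        (φ.f j).lTensor K[X] (A.polyD h x) = B.polyD h ((φ.f i).lTensor K[X] x) := by
      intro x
      induction x with
      | zero => simp
      | add x y hx hy => simp only [map_add, hx, hy]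
      | tmul f x => simp [φ.comm_d]
    exact key x
  comm_br {p q r} h x y := by
    have key : ∀ (x : K[X] ⊗[K] A.X p) (y : K[X] ⊗[K] A.X q),
        (φ.f r).lTensor K[X] (A.polyBr h x y) =
          B.polyBr h ((φ.f p).lTensor K[X] x) ((φ.f q).lTensor K[X] y) := by
      intro x y
      induction x with
      | zero => simp
      | add x₁ x₂ h₁ h₂ => simp only [map_add, LinearMap.add_apply, h₁, h₂]
      | tmul f x =>
        induction y with
        | zero => simp
        | add y₁ y₂ h₁ h₂ => simp only [map_add, h₁, h₂]
        | tmul f' y => simp [φ.comm_br]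
    exact key x y

lemma polyMap_der {A B : DGLA K} (φ : A ⟶ B) (n : ℤ) (x : (poly A).X n) :
    (polyMap φ).f n (A.polyDer n x) = B.polyDer n ((polyMap φ).f n x) := by
  have key : ∀ x : K[X] ⊗[K] A.X n, (φ.f n).lTensor K[X] (derivT (A.X n) x) =
      derivT (B.X n) ((φ.f n).lTensor K[X] x) := by
    intro x
    induction x with
    | zero => simp
    | add x y hx hy => simp only [map_add, hx, hy]
    | tmul f x => rfl
  exact key x

/-- The functoriality of `Ω(Δ¹; g)`. -/
noncomputable def formsMap {A B : DGLA K} (φ : A ⟶ B) : forms A ⟶ forms B where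
  f n := ((polyMap φ).f n).prodMap ((polyMap φ).f (n - 1))
  comm_d {i j} h := by
    rintro ⟨a, b⟩
    refine Prod.ext ((polyMap φ).comm_d h a) ?_
    show (polyMap φ).f (j - 1) ((poly A).reindex _ (A.polyDer i a) - (poly A).d _ b) =
      (poly B).reindex _ (B.polyDer i ((polyMap φ).f i a)) - (poly B).d _ ((polyMap φ).f (i - 1) b)
    rw [map_sub, reindex_f, polyMap_der, (polyMap φ).comm_d]
  comm_br {p q r} h := by
    rintro ⟨a, b⟩ ⟨a', b'⟩
    refine Prod.ext ((polyMap φ).comm_br h a a') ?_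
    show (polyMap φ).f (r - 1) ((poly A).br _ b a' + p.negOnePow • (poly A).br _ a b') =
      (poly B).br _ ((polyMap φ).f (p - 1) b) ((polyMap φ).f q a') +
        p.negOnePow • (poly B).br _ ((polyMap φ).f p a) ((polyMap φ).f (q - 1) b')
    rw [map_add, map_sign, (polyMap φ).comm_br, (polyMap φ).comm_br]

/-- The evaluation `K[t] ⊗ V ⟶ V` at `t = c`. -/
noncomputable def evalT (c : K) (V : Type u) [AddCommGroup V] [Module K V] :
    K[X] ⊗[K] V →ₗ[K] V :=
  (TensorProduct.lid K V).toLinearMap ∘ₗ (Polynomial.leval c).rTensor V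

@[simp] lemma evalT_tmul (c : K) (V : Type u) [AddCommGroup V] [Module K V] (f : K[X]) (v : V) :
    evalT c V (f ⊗ₜ v) = f.eval c • v := by
  simp [evalT]

/-- The evaluation `K[t] ⊗ g^n ⟶ g^n` at `t = c`. -/
noncomputable def polyEval (c : K) (g : DGLA K) (n : ℤ) : (poly g).X n →ₗ[K] g.X n :=
  evalT c (g.X n)

/-- The evaluation `Ω(Δ¹; g) ⟶ g` of forms at the point `t = c`. -/
noncomputable def ev (c : K) (g : DGLA K) : forms g ⟶ g where
  f n := polyEval c g n ∘ₗ LinearMap.fst K ((poly g).X n) ((poly g).X (n - 1))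
  comm_d {i j} h := by
    rintro ⟨a, b⟩
    show evalT c (g.X j) (g.polyD h a) = g.d h (evalT c (g.X i) a)
    have key : ∀ a : K[X] ⊗[K] g.X i,
        evalT c (g.X j) (g.polyD h a) = g.d h (evalT c (g.X i) a) := by
      intro a
      induction a with
      | zero => simp
      | add x y hx hy => simp only [map_add, hx, hy]
      | tmul f x => simp
    exact key a
  comm_br {p q r} h := by
    rintro ⟨a, b⟩ ⟨a', b'⟩
    have key : ∀ (a : K[X] ⊗[K] g.X p) (a' : K[X] ⊗[K] g.X q),
        evalT c (g.X r) (g.polyBr h a a') =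
          g.br h (evalT c (g.X p) a) (evalT c (g.X q) a') := by
      intro a a'
      induction a with
      | zero => simp
      | add x₁ x₂ h₁ h₂ => simp only [map_add, LinearMap.add_apply, h₁, h₂]
      | tmul f x =>
        induction a' with
        | zero => simp
        | add y₁ y₂ h₁ h₂ => simp only [map_add, h₁, h₂]
        | tmul f' y => simp [smul_smul, mul_comm]
    exact key a a'

lemma ev_naturality (c : K) {A B : DGLA K} (φ : A ⟶ B) (n : ℤ) (x : (forms A).X n) :
    (ev c B).f n ((formsMap φ).f n x) = φ.f n ((ev c A).f n x) := by
  have key : ∀ a : K[X] ⊗[K] A.X n,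
      evalT c (B.X n) ((φ.f n).lTensor K[X] a) = φ.f n (evalT c (A.X n) a) := by
    intro a
    induction a with
    | zero => simp
    | add x y hx hy => simp only [map_add, hx, hy]
    | tmul f x => simp
  exact key x.1

lemma formsMap_comp_apply {A B C : DGLA K} (φ : A ⟶ B) (ψ : B ⟶ C) (n : ℤ) (x : (forms A).X n) :
    (formsMap (φ ≫ ψ)).f n x = (formsMap ψ).f n ((formsMap φ).f n x) := by
  have key : ∀ (n : ℤ) (a : K[X] ⊗[K] A.X n),
      (ψ.f n ∘ₗ φ.f n).lTensor K[X] a =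
        (ψ.f n).lTensor K[X] ((φ.f n).lTensor K[X] a) := fun n a => by
    rw [LinearMap.lTensor_comp, LinearMap.comp_apply]
  exact Prod.ext (key _ x.1) (key _ x.2)

/-- The integral `∫₀¹ : K[t] ⟶ K`, with `∫₀¹ t^k = 1 / (k + 1)`. -/
noncomputable def intPoly (K : Type u) [Field K] : K[X] →ₗ[K] K :=
  Polynomial.lsum fun k => ((k : K) + 1)⁻¹ • LinearMap.id

/-- The integral `∫₀¹ : K[t] ⊗ g^n ⟶ g^n`. -/
noncomputable def polyInt (g : DGLA K) (n : ℤ) : (poly g).X n →ₗ[K] g.X n :=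
  show K[X] ⊗[K] g.X n →ₗ[K] g.X n from
    (TensorProduct.lid K (g.X n)).toLinearMap ∘ₗ (intPoly K).rTensor (g.X n)

/-- The integral `∫_{Δ¹} (a + dt b) = ∫₀¹ b`, a map `Ω(Δ¹; g)^n ⟶ g^m` for `m = n - 1`. -/
noncomputable def integral (g : DGLA K) {n m : ℤ} (h : m + 1 = n) : (forms g).X n →ₗ[K] g.X m :=
  g.reindex (by omega : n - 1 = m) ∘ₗ polyInt g (n - 1) ∘ₗ
    LinearMap.snd K ((poly g).X n) ((poly g).X (n - 1))

/-! ### The Thom-Whitney models of the homotopy fiber and of the double homotopy fiber -/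

section

variable {A B C : DGLA K}

lemma congr_f {φ ψ : A ⟶ B} (h : φ = ψ) (n : ℤ) (x : A.X n) : φ.f n x = ψ.f n x := by rw [h]

lemma vanish_add (φ : A ⟶ B) {n : ℤ} {x x' : A.X n} (h : φ.f n x = 0) (h' : φ.f n x' = 0) :
    φ.f n (x + x') = 0 := by rw [map_add, h, h', add_zero]

lemma vanish_smul (φ : A ⟶ B) {n : ℤ} (c : K) {x : A.X n} (h : φ.f n x = 0) :
    φ.f n (c • x) = 0 := by rw [map_smul, h, smul_zero]

lemma vanish_d (φ : A ⟶ B) {i j : ℤ} (hij : i + 1 = j) {x : A.X i} (h : φ.f i x = 0) :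
    φ.f j (A.d hij x) = 0 := by rw [φ.comm_d, h, map_zero]

lemma vanish_br (φ : A ⟶ B) {p q r : ℤ} (hpq : p + q = r) {x : A.X p} (h : φ.f p x = 0)
    (y : A.X q) : φ.f r (A.br hpq x y) = 0 := by rw [φ.comm_br, h, map_zero, LinearMap.zero_apply]

lemma agree_zero (φ : A ⟶ C) (ψ : B ⟶ C) (n : ℤ) : φ.f n 0 = ψ.f n 0 := by
  rw [map_zero, map_zero]

lemma agree_add (φ : A ⟶ C) (ψ : B ⟶ C) {n : ℤ} {x x' : A.X n} {y y' : B.X n}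
    (h : φ.f n x = ψ.f n y) (h' : φ.f n x' = ψ.f n y') : φ.f n (x + x') = ψ.f n (y + y') := by
  rw [map_add, map_add, h, h']

lemma agree_smul (φ : A ⟶ C) (ψ : B ⟶ C) {n : ℤ} (c : K) {x : A.X n} {y : B.X n}
    (h : φ.f n x = ψ.f n y) : φ.f n (c • x) = ψ.f n (c • y) := by
  rw [map_smul, map_smul, h]

lemma agree_d (φ : A ⟶ C) (ψ : B ⟶ C) {i j : ℤ} (hij : i + 1 = j) {x : A.X i} {y : B.X i}
    (h : φ.f i x = ψ.f i y) : φ.f j (A.d hij x) = ψ.f j (B.d hij y) := by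
  rw [φ.comm_d, ψ.comm_d, h]

lemma agree_br (φ : A ⟶ C) (ψ : B ⟶ C) {p q r : ℤ} (hpq : p + q = r) {x : A.X p} {y : B.X p}
    {x' : A.X q} {y' : B.X q} (h : φ.f p x = ψ.f p y) (h' : φ.f q x' = ψ.f q y') :
    φ.f r (A.br hpq x x') = ψ.f r (B.br hpq y y') := by
  rw [φ.comm_br, ψ.comm_br, h, h']

end

/-- The pairs `(ω₀, ω₁)` with `ω₁|₀ = 0` and `ω₁|₁ = φ(ω₀)`. -/
def twSub {A B : DGLA K} (φ : A ⟶ B) (n : ℤ) : Submodule K ((prod A (forms B)).X n) where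
  carrier := {ω : A.X n × (forms B).X n |
    (ev 0 B).f n ω.2 = 0 ∧ (ev 1 B).f n ω.2 = φ.f n ω.1}
  zero_mem' := ⟨map_zero ((ev 0 B).f n), agree_zero (ev 1 B) φ n⟩
  add_mem' h h' := ⟨vanish_add _ h.1 h'.1, agree_add _ _ h.2 h'.2⟩
  smul_mem' c _ h := ⟨vanish_smul _ c h.1, agree_smul _ _ c h.2⟩

/-- The Thom-Whitney model `TW(φ)` of the homotopy fiber of a morphism `φ : A ⟶ B`, the DG-Lie
subalgebra `{(ω₀, ω₁) | ω₁|₀ = 0, ω₁|₁ = φ(ω₀)}` of `A × Ω(Δ¹; B)`. -/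
noncomputable def TW {A B : DGLA K} (φ : A ⟶ B) : DGLA K :=
  sub (prod A (forms B)) (twSub φ)
    (fun hij _ h => ⟨vanish_d _ hij h.1, agree_d _ _ hij h.2⟩)
    (fun hpq _ h _ h' => ⟨vanish_br _ hpq h.1 _, agree_br _ _ hpq h.2 h'.2⟩)

/-- The map `(ω₀, ω₁) ↦ ∫_{Δ¹} ω₁`. -/
noncomputable def twIntegral {A B : DGLA K} (φ : A ⟶ B) {n m : ℤ} (hm : m + 1 = n)
    (ω : (TW φ).X n) : B.X m :=
  integral B hm (show (prod A (forms B)).X n from ω.1).2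

/-- A commutative square of DG-Lie algebras
```
A00 --h0--> A01
 |           |
v0          v1
 ↓           ↓
A10 --h1--> A11
```
-/
structure Square (K : Type u) [Field K] where
  (A00 A01 A10 A11 : DGLA K)
  h0 : A00 ⟶ A01
  v0 : A00 ⟶ A10
  h1 : A10 ⟶ A11
  v1 : A01 ⟶ A11
  comm : h0 ≫ v1 = v0 ≫ h1

/-- A morphism of commutative squares. -/
structure SquareHom (S T : Square K) where
  f00 : S.A00 ⟶ T.A00
  f01 : S.A01 ⟶ T.A01
  f10 : S.A10 ⟶ T.A10
  f11 : S.A11 ⟶ T.A11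
  comm_h0 : S.h0 ≫ f01 = f00 ≫ T.h0
  comm_v0 : S.v0 ≫ f10 = f00 ≫ T.v0
  comm_h1 : S.h1 ≫ f11 = f10 ≫ T.h1
  comm_v1 : S.v1 ≫ f11 = f01 ≫ T.v1

/-- The product `A00 × Ω(Δ¹; A10) × Ω(Δ¹; A01) × Ω(Δ¹ × Δ¹; A11)`. The coordinates of `Δ¹ × Δ¹` are
`(t₀, t₁)`, with `t₀` corresponding to the first index and `t₁` to the second one, and
`Ω(Δ¹ × Δ¹; A11) = Ω(Δ¹) ⊗ Ω(Δ¹) ⊗ A11` is written as forms in `t₁` whose coefficients are forms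
in `t₀`. -/
noncomputable def Square.formsProd (S : Square K) : DGLA K :=
  prod S.A00 (prod (forms S.A10) (prod (forms S.A01) (forms (forms S.A11))))

/-- The conditions on a quadruple `(ω₀₀, ω₁₀, ω₀₁, ω₁₁)`. -/
structure Square.IsTW2 (S : Square K) {n : ℤ} (w00 : S.A00.X n) (w10 : (forms S.A10).X n)
    (w01 : (forms S.A01).X n) (w11 : (forms (forms S.A11)).X n) : Prop where
  w10_zero : (ev 0 S.A10).f n w10 = 0
  w10_one : (ev 1 S.A10).f n w10 = S.v0.f n w00
  w01_zero : (ev 0 S.A01).f n w01 = 0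
  w01_one : (ev 1 S.A01).f n w01 = S.h0.f n w00
  /-- the restriction of `ω₁₁` to `t₀ = 0` -/
  w11_left : (formsMap (ev 0 S.A11)).f n w11 = 0
  /-- the restriction of `ω₁₁` to `t₀ = 1` -/
  w11_right : (formsMap (ev 1 S.A11)).f n w11 = (formsMap S.v1).f n w01
  /-- the restriction of `ω₁₁` to `t₁ = 0` -/
  w11_bot : (ev 0 (forms S.A11)).f n w11 = 0
  /-- the restriction of `ω₁₁` to `t₁ = 1` -/
  w11_top : (ev 1 (forms S.A11)).f n w11 = (formsMap S.h1).f n w10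

/-- The subspaces underlying the Thom-Whitney model of the double homotopy fiber. -/
def Square.tw2Sub (S : Square K) (n : ℤ) : Submodule K (S.formsProd.X n) where
  carrier := {ω : S.A00.X n × (forms S.A10).X n × (forms S.A01).X n × (forms (forms S.A11)).X n |
    S.IsTW2 ω.1 ω.2.1 ω.2.2.1 ω.2.2.2}
  zero_mem' := ⟨map_zero ((ev 0 S.A10).f n), agree_zero (ev 1 S.A10) S.v0 n,
    map_zero ((ev 0 S.A01).f n), agree_zero (ev 1 S.A01) S.h0 n,
    map_zero ((formsMap (ev 0 S.A11)).f n), agree_zero (formsMap (ev 1 S.A11)) (formsMap S.v1) n,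
    map_zero ((ev 0 (forms S.A11)).f n), agree_zero (ev 1 (forms S.A11)) (formsMap S.h1) n⟩
  add_mem' h h' := ⟨vanish_add _ h.1 h'.1, agree_add _ _ h.2 h'.2,
    vanish_add _ h.3 h'.3, agree_add _ _ h.4 h'.4, vanish_add _ h.5 h'.5,
    agree_add _ _ h.6 h'.6, vanish_add _ h.7 h'.7, agree_add _ _ h.8 h'.8⟩
  smul_mem' c _ h := ⟨vanish_smul _ c h.1, agree_smul _ _ c h.2, vanish_smul _ c h.3,
    agree_smul _ _ c h.4, vanish_smul _ c h.5, agree_smul _ _ c h.6, vanish_smul _ c h.7,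
    agree_smul _ _ c h.8⟩

/-- The Thom-Whitney model `TW^[2]` of the double homotopy fiber of a commutative square: the DG-Lie
subalgebra of `A00 × Ω(Δ¹; A10) × Ω(Δ¹; A01) × Ω(Δ¹ × Δ¹; A11)` of the compatible quadruples. -/
noncomputable def TW2 (S : Square K) : DGLA K :=
  sub S.formsProd S.tw2Sub
    (fun hij _ h => ⟨vanish_d _ hij h.1, agree_d _ _ hij h.2, vanish_d _ hij h.3,
      agree_d _ _ hij h.4, vanish_d _ hij h.5, agree_d _ _ hij h.6, vanish_d _ hij h.7,
      agree_d _ _ hij h.8⟩)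
    (fun hpq _ h _ h' => ⟨vanish_br _ hpq h.1 _, agree_br _ _ hpq h.2 h'.2,
      vanish_br _ hpq h.3 _, agree_br _ _ hpq h.4 h'.4, vanish_br _ hpq h.5 _,
      agree_br _ _ hpq h.6 h'.6, vanish_br _ hpq h.7 _, agree_br _ _ hpq h.8 h'.8⟩)

/-- The map `(ω₀₀, ω₁₀, ω₀₁, ω₁₁) ↦ ∫_{Δ¹ × Δ¹} ω₁₁`: integration along `t₁`, then along `t₀`.
It sends `dt₁ dt₀ ⊗ y` to `y`. -/
noncomputable def tw2Integral (S : Square K) {n m k : ℤ} (hm : m + 1 = n) (hk : k + 1 = m)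
    (ω : (TW2 S).X n) : S.A11.X k :=
  integral S.A11 hk (integral (forms S.A11) hm
    (show S.A00.X n × (forms S.A10).X n × (forms S.A01).X n × (forms (forms S.A11)).X n
      from ω.1).2.2.2)

/-- The projection `TW^[2](A••) ⟶ TW(A0•)`, `(ω₀₀, ω₁₀, ω₀₁, ω₁₁) ↦ (ω₀₀, ω₀₁)`. -/
noncomputable def tw2Proj (S : Square K) : TW2 S ⟶ TW S.h0 where
  f n := (((LinearMap.fst K _ _).prod
    (LinearMap.fst K _ _ ∘ₗ LinearMap.snd K _ _ ∘ₗ LinearMap.snd K _ _) :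
      S.A00.X n × (forms S.A10).X n × (forms S.A01).X n × (forms (forms S.A11)).X n →ₗ[K]
        S.A00.X n × (forms S.A01).X n).restrict
          (p := S.tw2Sub n) (q := twSub S.h0 n) (fun _ h => ⟨h.w01_zero, h.w01_one⟩))
  comm_d _ _ := rfl
  comm_br _ _ _ := rfl

lemma formsMap_comm {A B C D : DGLA K} {f : A ⟶ B} {g : B ⟶ D} {f' : A ⟶ C} {g' : C ⟶ D}
    (h : f ≫ g = f' ≫ g') (n : ℤ) (x : (forms A).X n) :
    (formsMap g).f n ((formsMap f).f n x) = (formsMap g').f n ((formsMap f').f n x) := by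
  rw [← formsMap_comp_apply, h, formsMap_comp_apply]

lemma ev_naturality' (c : K) {A B : DGLA K} (φ : A ⟶ B) :
    formsMap φ ≫ ev c B = ev c A ≫ φ :=
  Hom.ext (funext fun n => LinearMap.ext fun x => ev_naturality c φ n x)

/-- The functoriality of `TW^[2]`. -/
noncomputable def tw2Map {S T : Square K} (F : SquareHom S T) : TW2 S ⟶ TW2 T where
  f n := (((F.f00.f n).prodMap (((formsMap F.f10).f n).prodMap
    (((formsMap F.f01).f n).prodMap ((formsMap (formsMap F.f11)).f n)))).restrict
      (p := S.tw2Sub n) (q := T.tw2Sub n) (by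
        rintro ⟨w00, w10, w01, w11⟩ ⟨h₁, h₂, h₃, h₄, h₅, h₆, h₇, h₈⟩
        dsimp only at h₁ h₂ h₃ h₄ h₅ h₆ h₇ h₈
        refine ⟨?_, ?_, ?_, ?_, ?_, ?_, ?_, ?_⟩
        · exact (ev_naturality 0 F.f10 n w10).trans (by rw [h₁, map_zero])
        · exact (ev_naturality 1 F.f10 n w10).trans (by rw [h₂]; exact congr_f F.comm_v0 n w00)
        · exact (ev_naturality 0 F.f01 n w01).trans (by rw [h₃, map_zero])
        · exact (ev_naturality 1 F.f01 n w01).trans (by rw [h₄]; exact congr_f F.comm_h0 n w00)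
        · exact (formsMap_comm (ev_naturality' 0 F.f11) n w11).trans (by rw [h₅, map_zero])
        · exact (formsMap_comm (ev_naturality' 1 F.f11) n w11).trans
            (by rw [h₆]; exact formsMap_comm F.comm_v1 n w01)
        · exact (ev_naturality 0 (formsMap F.f11) n w11).trans (by rw [h₇, map_zero])
        · exact (ev_naturality 1 (formsMap F.f11) n w11).trans
            (by rw [h₈]; exact formsMap_comm F.comm_h1 n w10)))
  comm_d h x := Subtype.ext (Prod.ext (F.f00.comm_d h _) (Prod.ext ((formsMap F.f10).comm_d h _)
    (Prod.ext ((formsMap F.f01).comm_d h _) ((formsMap (formsMap F.f11)).comm_d h _))))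
  comm_br h x y := Subtype.ext (Prod.ext (F.f00.comm_br h _ _)
    (Prod.ext ((formsMap F.f10).comm_br h _ _)
      (Prod.ext ((formsMap F.f01).comm_br h _ _) ((formsMap (formsMap F.f11)).comm_br h _ _))))

/-- The square is a fiber product (in every degree): `A00 = A10 ×_{A11} A01`. -/
def Square.IsFiberProduct (S : Square K) : Prop :=
  ∀ (n : ℤ) (y : S.A10.X n) (z : S.A01.X n), S.h1.f n y = S.v1.f n z →
    ∃! x : S.A00.X n, S.v0.f n x = y ∧ S.h0.f n x = z

/-- The DG vector space `B / f(A)`. -/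
def quotRange {A B : DGLA K} (f : A ⟶ B) : DGVect K :=
  B.toDGVect.quot (fun n => LinearMap.range (f.f n)) (by
    rintro i j h _ ⟨x, rfl⟩
    exact ⟨A.d h x, f.comm_d h x⟩)

/-- The class in `B / f(A)` of an element of `B`. -/
def quotRangeMk {A B : DGLA K} (f : A ⟶ B) (n : ℤ) : B.X n →ₗ[K] (quotRange f).X n :=
  (LinearMap.range (f.f n)).mkQ

/-- The DG vector space `C / (f(A) + g(B))`. -/
def quotSum {A B C : DGLA K} (f : A ⟶ C) (g : B ⟶ C) : DGVect K :=
  C.toDGVect.quot (fun n => LinearMap.range (f.f n) ⊔ LinearMap.range (g.f n)) (by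
    intro i j h
    refine sup_le ?_ ?_
    · rintro _ ⟨x, rfl⟩
      exact Submodule.mem_sup_left ⟨A.d h x, f.comm_d h x⟩
    · rintro _ ⟨x, rfl⟩
      exact Submodule.mem_sup_right ⟨B.d h x, g.comm_d h x⟩)

/-- The class in `C / (f(A) + g(B))` of an element of `C`. -/
def quotSumMk {A B C : DGLA K} (f : A ⟶ C) (g : B ⟶ C) (n : ℤ) :
    C.X n →ₗ[K] (quotSum f g).X n :=
  (LinearMap.range (f.f n) ⊔ LinearMap.range (g.f n)).mkQ

end DGLA

/-! ## Cartan calculi -/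

open CategoryTheory DGLA

/-- A Cartan calculus: a commutative square
```
    g00  ----h---->  g10
     |                |
     |                χ
     ↓                ↓
cone(Id_g00) --c-->  g11
```
of DG-Lie algebras, whose left vertical arrow is the inclusion. -/
structure CartanCalculus (K : Type u) [Field K] where
  (g00 g10 g11 : DGLA K)
  h : g00 ⟶ g10
  χ : g10 ⟶ g11
  c : cone g00 ⟶ g11
  comm : h ≫ χ = coneIncl g00 ≫ c

namespace CartanCalculus

variable {K : Type u} [Field K]

/-- The Cartan homotopy `i = c ∘ ♭ : g00 ⟶ g11` of a Cartan calculus, of degree `-1`. -/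
def i (C : CartanCalculus K) {m k : ℤ} (hk : k + 1 = m) : C.g00.X m →ₗ[K] C.g11.X k :=
  C.c.f k ∘ₗ flat C.g00 hk

/-- A morphism of Cartan calculi: a morphism of the commutative squares which is `cone(f00)` on the
cones. -/
structure Morphism (C D : CartanCalculus K) where
  f00 : C.g00 ⟶ D.g00
  f10 : C.g10 ⟶ D.g10
  f11 : C.g11 ⟶ D.g11
  comm_h : C.h ≫ f10 = f00 ≫ D.h
  comm_χ : C.χ ≫ f11 = f10 ≫ D.χ
  comm_c : C.c ≫ f11 = coneMap f00 ≫ D.c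

namespace Morphism

variable {C₀ C₁ : CartanCalculus K} (F : Morphism C₀ C₁)

/-- The commutative square
```
    g000    ---->      g001
     |                  |
     ↓                  ↓
cone(Id_g000) ----> cone(Id_g001)
```
-/
def coneSquare : Square K where
  A00 := C₀.g00
  A01 := C₁.g00
  A10 := cone C₀.g00
  A11 := cone C₁.g00
  h0 := F.f00
  v0 := coneIncl C₀.g00
  h1 := coneMap F.f00
  v1 := coneIncl C₁.g00
  comm := Hom.ext (funext fun n => LinearMap.ext fun _ =>
    Prod.ext rfl (map_zero (F.f00.f (n + 1))).symm)

/-- The commutative square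
```
g100 ----> g101
 |          |
 ↓          ↓
g110 ----> g111
```
-/
def targetSquare : Square K where
  A00 := C₀.g10
  A01 := C₁.g10
  A10 := C₀.g11
  A11 := C₁.g11
  h0 := F.f10
  v0 := C₀.χ
  h1 := F.f11
  v1 := C₁.χ
  comm := F.comm_χ.symm

/-- The morphism of squares given by the horizontal arrows of the two Cartan calculi. -/
def squareHom : SquareHom F.coneSquare F.targetSquare where
  f00 := C₀.h
  f01 := C₁.h
  f10 := C₀.c
  f11 := C₁.c
  comm_h0 := F.comm_h.symm
  comm_v0 := C₀.comm.symm
  comm_h1 := F.comm_c.symm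
  comm_v1 := C₁.comm.symm

/-- The left leg `TW^[2](cone square) ⟶ TW(g_{00•})` of the span presenting the morphism
`hofib(g_{00•}) ⟶ hofib^[2](g_{1••})` of the homotopy category. -/
noncomputable def spanLeft : TW2 F.coneSquare ⟶ TW F.f00 := tw2Proj F.coneSquare

/-- The right leg `TW^[2](cone square) ⟶ TW^[2](g_{1••})` of the span. -/
noncomputable def spanRight : TW2 F.coneSquare ⟶ TW2 F.targetSquare := tw2Map F.squareHom

/-- The morphism `hofib(g_{00•}) ⟶ hofib^[2](g_{1••})` in the homotopy category of DG-Lie algebras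
presented by the span. -/
noncomputable def hofibMap (hF : quasiIso K F.spanLeft) :
    (toHo K).obj (TW F.f00) ⟶ (toHo K).obj (TW2 F.targetSquare) :=
  spanHo F.spanLeft hF F.spanRight

end Morphism

end CartanCalculus

/-! Everything rests on two operations on forms on the interval. The antiderivative `formsAnti`, `a
+ dt b ↦ ∫₀ᵗ b`, is a primitive of every closed form that vanishes at `t = 0`, and its value at `t =
1` is the integral (`d_formsAnti`, `ev_one_formsAnti`). The form `d(t x)` is closed, vanishes at `t
= 0`, takes the value `dx` at `t = 1` and has integral `x`; it prescribes or corrects integrals and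
endpoint values without disturbing closedness.

Single fiber. Stokes' formula (`integral_d`) gives `d∫ω₁ = φ(ω₀)` on cocycles, so `∫ω₁` is a cocycle
modulo `A`. If `∫ω₁ = dz + φ(a)`, then `(a, ∫₀ᵗω₁ - d(tz))` is a primitive of `(ω₀, ω₁)`; if `dx =
φ(a)`, then `(a, d(tx))` is a cocycle with integral `x`.

Double fiber. The same argument runs first along `t₁`, leaving a form `η = ∫ω₁₁` in `t₀`, and then
along `t₀`. The component in `A₀₀` of the element sought has prescribed images in `A₁₀` and `A₀₁`;
these agree in `A₁₁`, so the fiber product supplies it.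

The span. The lower row of the square of cones is acyclic, so the left leg is injective in
cohomology (`mem_coboundaries_of_tw2Proj`). For surjectivity, `exists_tw2Proj_sub_mem` lifts a
cocycle `(ω₀₀, ω₀₁)`, up to a coboundary, from a primitive `p` of `ω₀₀` in `A₁₀` and a `z` with `dz
= ∫ω₀₁ - p` in `A₁₁`; the lift has double integral `z`. In the cones `d♭x = x - ♭dx`, so `p = ♭ω₀₀`
and `z = ♭∫ω₀₁` are allowed. The right leg applies `c₁` to the double integral, turning `♭∫ω₀₁` into
`i₁` of `∫ω₀₁`: this is the third claim. -/

namespace DGVect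

/-! ### Cohomology through representatives -/

variable {K : Type u} [Field K] {V W : DGVect K}

lemma mem_cocycles {n j : ℤ} (h : n + 1 = j) (x : V.X n) : x ∈ V.cocycles n ↔ V.d h x = 0 := by
  subst h; rfl

lemma mem_coboundaries {n m : ℤ} (h : m + 1 = n) (x : V.X n) :
    x ∈ V.coboundaries n ↔ ∃ y : V.X m, V.d h y = x := by
  obtain rfl : m = n - 1 := by omega
  rfl

lemma exists_represents {n : ℤ} (a : V.H n) : ∃ x, V.Represents a x := by
  obtain ⟨⟨x, hx⟩, rfl⟩ := Submodule.mkQ_surjective _ a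
  exact ⟨x, hx, rfl⟩

lemma Represents.eq {n : ℤ} {a b : V.H n} {x : V.X n} (h : V.Represents a x)
    (h' : V.Represents b x) : a = b := by
  obtain ⟨hx, rfl⟩ := h
  obtain ⟨_, rfl⟩ := h'
  rfl

lemma Represents.eq_of_sub_mem {n : ℤ} {a b : V.H n} {x y : V.X n} (h : V.Represents a x)
    (h' : V.Represents b y) (hxy : x - y ∈ V.coboundaries n) : a = b := by
  obtain ⟨hx, rfl⟩ := h
  obtain ⟨hy, rfl⟩ := h'
  exact (Submodule.Quotient.eq _).2 hxy

/-- A linear map preserving cocycles and coboundaries induces a map in cohomology. -/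
def mapH {n m : ℤ} (g : V.X n →ₗ[K] W.X m) (hz : ∀ x ∈ V.cocycles n, g x ∈ W.cocycles m)
    (hb : ∀ x ∈ V.coboundaries n, g x ∈ W.coboundaries m) : V.H n →ₗ[K] W.H m :=
  Submodule.mapQ _ _ (g.restrict hz) fun x hx => hb x.1 hx

lemma mapH_represents {n m : ℤ} (g : V.X n →ₗ[K] W.X m)
    (hz : ∀ x ∈ V.cocycles n, g x ∈ W.cocycles m)
    (hb : ∀ x ∈ V.coboundaries n, g x ∈ W.coboundaries m) {a : V.H n} {x : V.X n}
    (h : V.Represents a x) : W.Represents (mapH g hz hb a) (g x) := by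
  obtain ⟨hx, rfl⟩ := h
  exact ⟨hz x hx, rfl⟩

/-- The criterion behind every bijection below. Since `f` is linear, its injectivity is a question
about coboundaries only, and surjectivity is needed only up to coboundaries. -/
lemma bijective_of_represents {n m : ℤ} (f : V.H n →ₗ[K] W.H m) (g : V.X n → W.X m)
    (hg : ∀ a x, V.Represents a x → W.Represents (f a) (g x))
    (hi : ∀ x ∈ V.cocycles n, g x ∈ W.coboundaries m → x ∈ V.coboundaries n)
    (hs : ∀ y ∈ W.cocycles m, ∃ x ∈ V.cocycles n, g x - y ∈ W.coboundaries m) :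
    Function.Bijective f := by
  constructor
  · rw [injective_iff_map_eq_zero]
    intro a ha
    obtain ⟨x, hx⟩ := exists_represents a
    obtain ⟨hgx, e⟩ := hg a x hx
    rw [ha] at e
    have hb : g x ∈ W.coboundaries m := (Submodule.Quotient.mk_eq_zero ((W.coboundaries m).submoduleOf _)).1 e
    obtain ⟨hx', rfl⟩ := hx
    exact (Submodule.Quotient.mk_eq_zero _).2 (hi x hx' hb)
  · intro b
    obtain ⟨y, hy⟩ := exists_represents b
    obtain ⟨x, hx, hxy⟩ := hs y hy.1
    exact ⟨_, (hg _ x ⟨hx, rfl⟩).eq_of_sub_mem hy hxy⟩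

end DGVect

/-! ### Maps in cohomology, and the morphism presented by a span -/

namespace DGLA

variable {K : Type u} [Field K]

lemma Hmap_represents {A B : DGLA K} (f : A ⟶ B) {n : ℤ} {a : A.H n} {x : A.X n}
    (h : A.Represents a x) : B.Represents (Hmap f n a) (f.f n x) := by
  obtain ⟨hx, rfl⟩ := h
  exact ⟨_, rfl⟩

/-- In the localization `l` followed by the morphism of the span is `r`. This determines the induced
map: every class of `A` is the image under `l` of a class of `S`. -/
lemma hoHmap_spanHo {S A B : DGLA K} (l : S ⟶ A) (hl : quasiIso K l) (r : S ⟶ B) (n : ℤ)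
    (s : S.H n) : hoHmap (spanHo l hl r) n (Hmap l n s) = Hmap r n s := by
  have key : (cohomology K n).map l ≫
      ((Localization.fac (cohomology K n) (quasiIso_inverted n) (toHo K)).inv.app A ≫
      (Localization.lift (cohomology K n) (quasiIso_inverted n) (toHo K)).map (spanHo l hl r) ≫
      (Localization.fac (cohomology K n) (quasiIso_inverted n) (toHo K)).hom.app B) =
      (cohomology K n).map r := by
    -- Naturality of the comparison isomorphism `fac` moves `l` inside the lifted functor, where it
    -- cancels the inverse in the span.
    rw [← Category.assoc, NatTrans.naturality, Category.assoc, Functor.comp_map,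
      ← Functor.map_comp_assoc]
    have : (toHo K).map l ≫ spanHo l hl r = (toHo K).map r := by
      rw [spanHo, ← Localization.isoOfHom_hom (toHo K) (quasiIso K) l hl,
        Iso.hom_inv_id_assoc]
    rw [this, ← Functor.comp_map, NatTrans.naturality, Iso.inv_hom_id_app_assoc]
  exact LinearMap.congr_fun (congrArg ModuleCat.Hom.hom key) s

/-! ### Antiderivatives of polynomial forms -/

/-- The antiderivative `∫₀ᵗ` on polynomials. -/
noncomputable def antiPoly (K : Type u) [Field K] : K[X] →ₗ[K] K[X] :=
  Polynomial.lsum fun k => ((k : K) + 1)⁻¹ • Polynomial.monomial (k + 1)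

lemma antiPoly_monomial (k : ℕ) (c : K) :
    antiPoly K (Polynomial.monomial k c) =
      Polynomial.monomial (k + 1) (((k : K) + 1)⁻¹ * c) := by
  simp [antiPoly, Polynomial.lsum_apply, Polynomial.smul_monomial]

lemma intPoly_monomial (k : ℕ) (c : K) :
    intPoly K (Polynomial.monomial k c) = ((k : K) + 1)⁻¹ * c := by
  simp [intPoly, Polynomial.lsum_apply]

lemma eval_zero_antiPoly (f : K[X]) : (antiPoly K f).eval 0 = 0 := by
  induction f using Polynomial.induction_on' with
  | add p q hp hq => simp [hp, hq]
  | monomial k c => simp [antiPoly_monomial]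

lemma eval_one_antiPoly (f : K[X]) : (antiPoly K f).eval 1 = intPoly K f := by
  induction f using Polynomial.induction_on' with
  | add p q hp hq => simp [hp, hq]
  | monomial k c => simp [antiPoly_monomial, intPoly_monomial]

/-- Characteristic `0` enters here: the factor `(k + 1)⁻¹` has to be a true inverse of `k + 1`. -/
lemma derivative_antiPoly [CharZero K] (f : K[X]) :
    Polynomial.derivative (antiPoly K f) = f := by
  induction f using Polynomial.induction_on' with
  | add p q hp hq => simp [hp, hq]
  | monomial k c =>
    have : (k : K) + 1 ≠ 0 := Nat.cast_add_one_ne_zero k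
    rw [antiPoly_monomial, Polynomial.derivative_monomial]
    congr 1
    push_cast
    field_simp

lemma antiPoly_derivative [CharZero K] (f : K[X]) :
    antiPoly K (Polynomial.derivative f) = f - Polynomial.C (f.eval 0) := by
  induction f using Polynomial.induction_on' with
  | add p q hp hq => simp only [map_add, hp, hq, Polynomial.eval_add]; abel
  | monomial k c =>
    rw [Polynomial.derivative_monomial, antiPoly_monomial]
    cases k with
    | zero => simp
    | succ k =>
      have : (k : K) + 1 ≠ 0 := Nat.cast_add_one_ne_zero k
      simp
      field_simp

/-- The antiderivative `∫₀ᵗ` on `K[t] ⊗ g^n`. -/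
noncomputable def polyAnti (g : DGLA K) (n : ℤ) : (poly g).X n →ₗ[K] (poly g).X n :=
  (antiPoly K).rTensor (g.X n)

/-- The constant forms in `K[t] ⊗ g^n`. -/
noncomputable def polyConst (g : DGLA K) (n : ℤ) : g.X n →ₗ[K] (poly g).X n :=
  TensorProduct.mk K K[X] (g.X n) 1

section

variable (g : DGLA K)

-- Tensor induction stated for the carrier `(poly g).X n`, so that it applies without unfolding
-- `poly`.
@[elab_as_elim]
lemma poly_induction {n : ℤ} {motive : (poly g).X n → Prop} (x : (poly g).X n)
    (zero : motive 0) (add : ∀ x y, motive x → motive y → motive (x + y))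
    (tmul : ∀ (f : K[X]) (v : g.X n), motive (show K[X] ⊗[K] g.X n from f ⊗ₜ[K] v)) : motive x :=
  TensorProduct.induction_on (motive := motive) x zero tmul add

lemma polyEval_zero_anti {n : ℤ} (x : (poly g).X n) : polyEval 0 g n (g.polyAnti n x) = 0 := by
  induction x using poly_induction with
  | zero => simp
  | add x y hx hy => simp only [map_add, hx, hy, add_zero]
  | tmul f v =>
    exact (evalT_tmul 0 (g.X n) (antiPoly K f) v).trans (by rw [eval_zero_antiPoly, zero_smul])

lemma polyEval_one_anti {n : ℤ} (x : (poly g).X n) :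
    polyEval 1 g n (g.polyAnti n x) = polyInt g n x := by
  induction x using poly_induction with
  | zero => simp
  | add x y hx hy => simp only [map_add, hx, hy]
  | tmul f v =>
    exact (evalT_tmul 1 (g.X n) (antiPoly K f) v).trans (by rw [eval_one_antiPoly]; rfl)

lemma polyDer_anti [CharZero K] {n : ℤ} (x : (poly g).X n) :
    g.polyDer n (g.polyAnti n x) = x := by
  induction x using poly_induction with
  | zero => simp
  | add x y hx hy => simp only [map_add, hx, hy]
  | tmul f v =>
    exact congrArg (fun p : K[X] => p ⊗ₜ[K] v) (derivative_antiPoly f)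

lemma polyAnti_der [CharZero K] {n : ℤ} (x : (poly g).X n) :
    g.polyAnti n (g.polyDer n x) =
      x - g.polyConst n (polyEval 0 g n x) := by
  induction x using poly_induction with
  | zero => simp
  | add x y hx hy => simp only [map_add, hx, hy]; abel
  | tmul f v =>
    have e : polyEval 0 g n (show K[X] ⊗[K] g.X n from f ⊗ₜ[K] v) = f.eval 0 • v :=
      evalT_tmul 0 _ f v
    rw [e]
    refine (congrArg (fun p : K[X] => p ⊗ₜ[K] v) (antiPoly_derivative f)).trans ?_
    refine (TensorProduct.sub_tmul _ _ _).trans (congrArg (f ⊗ₜ[K] v - ·) ?_)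
    refine Eq.trans ?_ (TensorProduct.tmul_smul (f.eval 0) (1 : K[X]) v).symm
    rw [TensorProduct.smul_tmul', Polynomial.smul_eq_C_mul, mul_one]

lemma polyAnti_d {i j : ℤ} (h : i + 1 = j) (x : (poly g).X i) :
    g.polyAnti j ((poly g).d h x) = (poly g).d h (g.polyAnti i x) := by
  induction x using poly_induction with
  | zero => simp
  | add x y hx hy => simp only [map_add, hx, hy]
  | tmul f v => rfl

lemma polyInt_d {i j : ℤ} (h : i + 1 = j) (x : (poly g).X i) :
    polyInt g j ((poly g).d h x) = g.d h (polyInt g i x) := by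
  induction x using poly_induction with
  | zero => simp
  | add x y hx hy => simp only [map_add, hx, hy]
  | tmul f v => exact ((g.d h).map_smul (intPoly K f) v).symm

lemma polyInt_der [CharZero K] {n : ℤ} (x : (poly g).X n) :
    polyInt g n (g.polyDer n x) = polyEval 1 g n x - polyEval 0 g n x := by
  rw [← polyEval_one_anti, polyAnti_der, map_sub]
  congr 1
  exact (evalT_tmul 1 (g.X n) 1 _).trans (by simp)

lemma polyMap_anti {A B : DGLA K} (φ : A ⟶ B) {n : ℤ} (x : (poly A).X n) :
    (polyMap φ).f n (A.polyAnti n x) = B.polyAnti n ((polyMap φ).f n x) := by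
  induction x using poly_induction with
  | zero => simp
  | add x y hx hy => simp only [map_add, hx, hy]
  | tmul f v => rfl

lemma polyMap_int {A B : DGLA K} (φ : A ⟶ B) {n : ℤ} (x : (poly A).X n) :
    φ.f n (polyInt A n x) = polyInt B n ((polyMap φ).f n x) := by
  induction x using poly_induction with
  | zero => simp
  | add x y hx hy => simp only [map_add, hx, hy]
  | tmul f v => exact (φ.f n).map_smul (intPoly K f) v

end

lemma polyInt_reindex (g : DGLA K) {n m : ℤ} (h : n = m) (x : (poly g).X n) :
    polyInt g m ((poly g).reindex h x) = g.reindex h (polyInt g n x) := by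
  subst h; rfl

lemma reindex_reindex {n m k : ℤ} (V : DGVect K) (h : n = m) (h' : m = k) (x : V.X n) :
    V.reindex h' (V.reindex h x) = V.reindex (h.trans h') x := by
  subst h h'; rfl

/-- The antiderivative `a + dt b ↦ ∫₀ᵗ b`, of degree `-1`. -/
noncomputable def formsAnti (g : DGLA K) {n m : ℤ} (h : m + 1 = n) :
    (forms g).X n →ₗ[K] (forms g).X m :=
  LinearMap.inl K ((poly g).X m) ((poly g).X (m - 1)) ∘ₗ (poly g).reindex (by omega : n - 1 = m) ∘ₗ
    g.polyAnti (n - 1) ∘ₗ LinearMap.snd K ((poly g).X n) ((poly g).X (n - 1))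

/-- The form `t x`. -/
noncomputable def timesT (g : DGLA K) (n : ℤ) : g.X n →ₗ[K] (forms g).X n :=
  LinearMap.inl K ((poly g).X n) ((poly g).X (n - 1)) ∘ₗ TensorProduct.mk K K[X] (g.X n) Polynomial.X

section

variable (g : DGLA K) {A B : DGLA K} {n m : ℤ}

lemma ev_zero_formsAnti (h : m + 1 = n) (ω : (forms g).X n) :
    (ev 0 g).f m (formsAnti g h ω) = 0 := by
  obtain rfl : m = n - 1 := by omega
  exact polyEval_zero_anti g _

lemma ev_one_formsAnti (h : m + 1 = n) (ω : (forms g).X n) :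
    (ev 1 g).f m (formsAnti g h ω) = integral g h ω := by
  obtain rfl : m = n - 1 := by omega
  exact polyEval_one_anti g _

/-- The Poincaré lemma. Closedness of `a + dt b` contains `∂a/∂t = db`, hence `d(∫₀ᵗ b) = ∫₀ᵗ ∂a/∂t
+ dt b = a - a(0) + dt b`, and `a(0) = 0`. -/
lemma d_formsAnti [CharZero K] (h : m + 1 = n) {ω : (forms g).X n} {j : ℤ} (hj : n + 1 = j)
    (hd : (forms g).d hj ω = 0) (h0 : (ev 0 g).f n ω = 0) :
    (forms g).d h (formsAnti g h ω) = ω := by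
  obtain rfl : m = n - 1 := by omega
  subst hj
  obtain ⟨a, b⟩ := ω
  have h0' : polyEval 0 g n a = 0 := h0
  have hd' : (poly g).reindex (by omega : n = n + 1 - 1) (g.polyDer n a) =
      (poly g).d (by omega : n - 1 + 1 = n + 1 - 1) b := sub_eq_zero.1 (congrArg Prod.snd hd)
  refine Prod.ext ?_ ?_
  · show (poly g).d h (g.polyAnti (n - 1) b) = a
    have e := congrArg ((poly g).reindex (by omega : n + 1 - 1 = n)) hd'
    rw [reindex_d _ _ _ h, reindex_reindex, DGVect.reindex_rfl] at e
    rw [← polyAnti_d, ← e, polyAnti_der, h0']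
    rw [map_zero, sub_zero]
  · show (poly g).reindex rfl (g.polyDer (n - 1) (g.polyAnti (n - 1) b)) - (poly g).d (sub_add_cancel (n - 1) 1) 0 = b
    rw [polyDer_anti, map_zero, sub_zero, DGVect.reindex_rfl]

/-- Stokes' formula. The interior term is negative because the differential of `g` picks up a sign
when it passes `dt`. -/
lemma integral_d [CharZero K] {k : ℤ} (h : m + 1 = n) (hk : k + 1 = m) (ω : (forms g).X m) :
    integral g h ((forms g).d h ω) =
      (ev 1 g).f m ω - (ev 0 g).f m ω - g.d hk (integral g hk ω) := by
  subst h hk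
  obtain ⟨a, b⟩ := ω
  show g.reindex _ (polyInt g _ ((poly g).reindex _ (g.polyDer _ a) - (poly g).d _ b)) =
    polyEval 1 g _ a - polyEval 0 g _ a - g.d _ (g.reindex _ (polyInt g _ b))
  rw [map_sub, map_sub, polyInt_d, reindex_d _ _ _ (by omega), d_reindex _ _ _ (by omega),
    polyInt_reindex, polyInt_der,
    reindex_reindex, DGVect.reindex_rfl]

lemma formsMap_formsAnti (φ : A ⟶ B) (h : m + 1 = n) (ω : (forms A).X n) :
    (formsMap φ).f m (formsAnti A h ω) = formsAnti B h ((formsMap φ).f n ω) := by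
  obtain rfl : m = n - 1 := by omega
  exact Prod.ext (polyMap_anti φ _) ((polyMap φ).f (n - 1 - 1)).map_zero

lemma integral_formsMap (φ : A ⟶ B) (h : m + 1 = n) (ω : (forms A).X n) :
    integral B h ((formsMap φ).f n ω) = φ.f m (integral A h ω) := by
  obtain rfl : m = n - 1 := by omega
  exact (polyMap_int φ ω.2).symm

/-- An antiderivative has no `dt` component, and `formsAnti` sees only that component. -/
lemma formsAnti_formsAnti {k : ℤ} (h : m + 1 = n) (hk : k + 1 = m) (ω : (forms g).X n) :
    formsAnti g hk (formsAnti g h ω) = 0 := by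
  subst hk
  exact (LinearMap.inl K ((poly g).X k) ((poly g).X (k - 1)) ∘ₗ (poly g).reindex (by omega) ∘ₗ
    g.polyAnti (k + 1 - 1)).map_zero

lemma ev_zero_timesT (x : g.X n) : (ev 0 g).f n (timesT g n x) = 0 :=
  (evalT_tmul 0 (g.X n) Polynomial.X x).trans (by simp)

lemma ev_one_timesT (x : g.X n) : (ev 1 g).f n (timesT g n x) = x :=
  (evalT_tmul 1 (g.X n) Polynomial.X x).trans (by simp)

lemma integral_timesT (h : m + 1 = n) (x : g.X n) : integral g h (timesT g n x) = 0 := by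
  subst h
  exact (g.reindex _ ∘ₗ polyInt g _).map_zero

lemma formsMap_timesT (φ : A ⟶ B) (x : A.X n) :
    (formsMap φ).f n (timesT A n x) = timesT B n (φ.f n x) :=
  Prod.ext rfl ((polyMap φ).f (n - 1)).map_zero

/-- With this, `d(t x)` serves as the standard closed form of integral `x`, from `0` at `t = 0` to
`dx` at `t = 1`. -/
lemma integral_d_timesT [CharZero K] (h : m + 1 = n) (x : g.X m) :
    integral g h ((forms g).d h (timesT g m x)) = x := by
  rw [integral_d g h (sub_add_cancel m 1), integral_timesT, ev_one_timesT, ev_zero_timesT,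
    map_zero, sub_zero, sub_zero]

end

end DGLA

/-! ### Relative cocycles and coboundaries: the cohomology of quotients -/

namespace DGVect

variable {K : Type u} [Field K] (V : DGVect K) (S : ∀ n, Submodule K (V.X n))
  (hS : ∀ {i j : ℤ} (h : i + 1 = j), S i ≤ (S j).comap (V.d h)) {m : ℤ} (x : V.X m)

lemma mkQ_mem_cocycles {j : ℤ} (h : m + 1 = j) :
    (show (V.quot S hS).X m from (S m).mkQ x) ∈ (V.quot S hS).cocycles m ↔ V.d h x ∈ S j := by
  rw [mem_cocycles h]
  exact Submodule.Quotient.mk_eq_zero (S j)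

lemma mkQ_mem_coboundaries {k : ℤ} (h : k + 1 = m) :
    (show (V.quot S hS).X m from (S m).mkQ x) ∈ (V.quot S hS).coboundaries m ↔
      ∃ y : V.X k, x - V.d h y ∈ S m := by
  rw [mem_coboundaries h]
  constructor
  · rintro ⟨y, hy⟩
    obtain ⟨y, rfl⟩ := Submodule.mkQ_surjective _ y
    exact ⟨y, (Submodule.Quotient.eq _).1 hy.symm⟩
  · rintro ⟨y, hy⟩
    exact ⟨(S k).mkQ y, ((Submodule.Quotient.eq (S m)).2 hy).symm⟩

end DGVect

namespace DGLA

variable {K : Type u} [Field K]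

section

variable {A B C : DGLA K}

lemma quotRangeMk_surjective (f : A ⟶ B) (m : ℤ) : Function.Surjective (quotRangeMk f m) :=
  Submodule.mkQ_surjective _

lemma quotSumMk_surjective (f : A ⟶ C) (g : B ⟶ C) (m : ℤ) :
    Function.Surjective (quotSumMk f g m) :=
  Submodule.mkQ_surjective _

lemma range_le_comap_d (f : A ⟶ B) {i j : ℤ} (h : i + 1 = j) :
    LinearMap.range (f.f i) ≤ (LinearMap.range (f.f j)).comap (B.d h) := by
  rintro _ ⟨x, rfl⟩
  exact ⟨A.d h x, f.comm_d h x⟩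

lemma range_sup_range_le_comap_d (f : A ⟶ C) (g : B ⟶ C) {i j : ℤ} (h : i + 1 = j) :
    LinearMap.range (f.f i) ⊔ LinearMap.range (g.f i) ≤
      (LinearMap.range (f.f j) ⊔ LinearMap.range (g.f j)).comap (C.d h) :=
  sup_le ((range_le_comap_d f h).trans (Submodule.comap_mono le_sup_left))
    ((range_le_comap_d g h).trans (Submodule.comap_mono le_sup_right))

lemma quotRangeMk_mem_cocycles (f : A ⟶ B) {m j : ℤ} (h : m + 1 = j) (x : B.X m) :
    quotRangeMk f m x ∈ (quotRange f).cocycles m ↔ ∃ a, f.f j a = B.d h x :=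
  DGVect.mkQ_mem_cocycles _ _ (range_le_comap_d f) x h

lemma quotRangeMk_mem_coboundaries (f : A ⟶ B) {m k : ℤ} (h : k + 1 = m) (x : B.X m) :
    quotRangeMk f m x ∈ (quotRange f).coboundaries m ↔ ∃ z a, x = B.d h z + f.f m a := by
  refine (DGVect.mkQ_mem_coboundaries _ _ (range_le_comap_d f) x h).trans (exists_congr fun z => ?_)
  exact exists_congr fun a => by rw [eq_sub_iff_add_eq', eq_comm]

lemma quotSumMk_mem_cocycles (f : A ⟶ C) (g : B ⟶ C) {m j : ℤ} (h : m + 1 = j) (x : C.X m) :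
    quotSumMk f g m x ∈ (quotSum f g).cocycles m ↔ ∃ a b, C.d h x = f.f j a + g.f j b := by
  refine (DGVect.mkQ_mem_cocycles _ _ (range_sup_range_le_comap_d f g) x h).trans ?_
  simp [Submodule.mem_sup, eq_comm]

lemma quotSumMk_mem_coboundaries (f : A ⟶ C) (g : B ⟶ C) {m k : ℤ} (h : k + 1 = m) (x : C.X m) :
    quotSumMk f g m x ∈ (quotSum f g).coboundaries m ↔
      ∃ z a b, x = C.d h z + f.f m a + g.f m b := by
  refine (DGVect.mkQ_mem_coboundaries _ _ (range_sup_range_le_comap_d f g) x h).trans (exists_congr fun z => ?_)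
  simp only [Submodule.mem_sup, LinearMap.mem_range, exists_exists_eq_and]
  refine exists_congr fun a => exists_congr fun b => ?_
  rw [eq_sub_iff_add_eq', eq_comm, add_assoc]

/-- The element `(ω₀, ω₁)` of `TW(φ)`. -/
def twMk (φ : A ⟶ B) {n : ℤ} (w0 : A.X n) (w1 : (forms B).X n) (h0 : (ev 0 B).f n w1 = 0)
    (h1 : (ev 1 B).f n w1 = φ.f n w0) : (TW φ).X n :=
  ⟨(w0, w1), h0, h1⟩

/-! ### Componentwise description of the Thom-Whitney models -/

variable {φ : A ⟶ B} {n : ℤ}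

lemma exists_twMk (ω : (TW φ).X n) : ∃ w0 w1 h0 h1, ω = twMk φ w0 w1 h0 h1 :=
  ⟨ω.1.1, ω.1.2, ω.2.1, ω.2.2, rfl⟩

lemma d_twMk_eq_iff {m : ℤ} (h : m + 1 = n) {a0 : A.X m} {a1 : (forms B).X m} {h0 h1}
    {w0 : A.X n} {w1 : (forms B).X n} {h0' h1'} :
    (TW φ).d h (twMk φ a0 a1 h0 h1) = twMk φ w0 w1 h0' h1' ↔
      A.d h a0 = w0 ∧ (forms B).d h a1 = w1 :=
  Subtype.ext_iff.trans Prod.ext_iff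

lemma d_twMk_eq_zero_iff {m : ℤ} (h : m + 1 = n) {a0 : A.X m} {a1 : (forms B).X m} {h0 h1} :
    (TW φ).d h (twMk φ a0 a1 h0 h1) = 0 ↔ A.d h a0 = 0 ∧ (forms B).d h a1 = 0 :=
  Subtype.ext_iff.trans Prod.ext_iff

lemma twMk_sub {w0 : A.X n} {w1 : (forms B).X n} {h0 h1} {w0' : A.X n} {w1' : (forms B).X n}
    {h0' h1'} : twMk φ w0 w1 h0 h1 - twMk φ w0' w1' h0' h1' =
      twMk φ (w0 - w0') (w1 - w1') (by rw [map_sub, h0, h0', sub_zero])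
        (by rw [map_sub, map_sub, h1, h1']) := rfl

lemma twIntegral_twMk {m : ℤ} (hm : m + 1 = n) {w0 : A.X n} {w1 : (forms B).X n} {h0 h1} :
    twIntegral φ hm (twMk φ w0 w1 h0 h1) = integral B hm w1 := rfl

end

section

variable {S : Square K} {n : ℤ}

/-- The element `(ω₀₀, ω₁₀, ω₀₁, ω₁₁)` of `TW^[2]`. -/
def tw2Mk (S : Square K) {n : ℤ} (w00 : S.A00.X n) (w10 : (forms S.A10).X n)
    (w01 : (forms S.A01).X n) (w11 : (forms (forms S.A11)).X n)
    (h : S.IsTW2 w00 w10 w01 w11) : (TW2 S).X n :=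
  ⟨(w00, w10, w01, w11), h⟩

lemma exists_tw2Mk (ω : (TW2 S).X n) : ∃ w00 w10 w01 w11 h, ω = tw2Mk S w00 w10 w01 w11 h :=
  ⟨ω.1.1, ω.1.2.1, ω.1.2.2.1, ω.1.2.2.2, ω.2, rfl⟩

variable {m : ℤ} (h : m + 1 = n) {a00 : S.A00.X m} {a10 : (forms S.A10).X m}
    {a01 : (forms S.A01).X m} {a11 : (forms (forms S.A11)).X m} {ha}
    {w00 : S.A00.X n} {w10 : (forms S.A10).X n}
    {w01 : (forms S.A01).X n} {w11 : (forms (forms S.A11)).X n} {hw}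

lemma d_tw2Mk_eq_iff :
    (TW2 S).d h (tw2Mk S a00 a10 a01 a11 ha) = tw2Mk S w00 w10 w01 w11 hw ↔
      S.A00.d h a00 = w00 ∧ (forms S.A10).d h a10 = w10 ∧ (forms S.A01).d h a01 = w01 ∧
        (forms (forms S.A11)).d h a11 = w11 := by
  refine Subtype.ext_iff.trans (Prod.ext_iff.trans (and_congr_right fun _ => ?_))
  exact Prod.ext_iff.trans (and_congr_right fun _ => Prod.ext_iff)

lemma d_tw2Mk_eq_zero_iff :
    (TW2 S).d h (tw2Mk S a00 a10 a01 a11 ha) = 0 ↔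
      S.A00.d h a00 = 0 ∧ (forms S.A10).d h a10 = 0 ∧ (forms S.A01).d h a01 = 0 ∧
        (forms (forms S.A11)).d h a11 = 0 := by
  refine Subtype.ext_iff.trans (Prod.ext_iff.trans (and_congr_right fun _ => ?_))
  exact Prod.ext_iff.trans (and_congr_right fun _ => Prod.ext_iff)

lemma tw2Integral_tw2Mk {k : ℤ} (hk : k + 1 = m) :
    tw2Integral S h hk (tw2Mk S w00 w10 w01 w11 hw) =
      integral S.A11 hk (integral (forms S.A11) h w11) := rfl

lemma tw2Proj_tw2Mk :
    (tw2Proj S).f n (tw2Mk S w00 w10 w01 w11 hw) = twMk S.h0 w00 w01 hw.w01_zero hw.w01_one := rfl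

/-- Integration acts on the polynomial factor only, so it commutes with maps of coefficients. For
the right leg of the span this brings in `c₁`. -/
lemma tw2Integral_tw2Map {S T : Square K} (F : SquareHom S T) {n m k : ℤ} (h : m + 1 = n)
    (hk : k + 1 = m) (ω : (TW2 S).X n) :
    tw2Integral T h hk ((tw2Map F).f n ω) = F.f11.f k (tw2Integral S h hk ω) := by
  obtain ⟨w00, w10, w01, w11, hw, rfl⟩ := exists_tw2Mk ω
  refine Eq.trans ?_ (integral_formsMap F.f11 hk (integral (forms S.A11) h w11))
  rw [← integral_formsMap]
  rfl

end

/-! ### The cohomology of the homotopy fiber of an inclusion -/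

section

variable {A B : DGLA K} (φ : A ⟶ B) {n m : ℤ} (hm : m + 1 = n)

/-- The map `(ω₀, ω₁) ↦ ∫_{Δ¹} ω₁` to `B / φ(A)`, as a linear map. -/
noncomputable def twIntegralMk : (TW φ).X n →ₗ[K] (quotRange φ).X m :=
  quotRangeMk φ m ∘ₗ integral B hm ∘ₗ LinearMap.snd K (A.X n) ((forms B).X n) ∘ₗ
    (twSub φ n).subtype

lemma twIntegralMk_twMk {w0 : A.X n} {w1 : (forms B).X n} {h0 h1} :
    twIntegralMk φ hm (twMk φ w0 w1 h0 h1) = quotRangeMk φ m (integral B hm w1) := rfl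

variable [CharZero K]

/-- Stokes: `0 = ∫dω₁ = φ(ω₀) - d∫ω₁`. -/
lemma twIntegralMk_mem_cocycles (ω : (TW φ).X n) (hω : ω ∈ (TW φ).cocycles n) :
    twIntegralMk φ hm ω ∈ (quotRange φ).cocycles m := by
  obtain ⟨w0, w1, h0, h1, rfl⟩ := exists_twMk ω
  obtain ⟨-, hd⟩ := (d_twMk_eq_zero_iff _).1 ((DGVect.mem_cocycles rfl _).1 hω)
  rw [twIntegralMk_twMk, quotRangeMk_mem_cocycles φ hm]
  have e := integral_d B rfl hm w1
  rw [hd, map_zero, h0, h1, sub_zero] at e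
  exact ⟨w0, sub_eq_zero.1 e.symm⟩

lemma twIntegralMk_mem_coboundaries (ω : (TW φ).X n) (hω : ω ∈ (TW φ).coboundaries n) :
    twIntegralMk φ hm ω ∈ (quotRange φ).coboundaries m := by
  obtain ⟨α, rfl⟩ := (DGVect.mem_coboundaries hm _).1 hω
  obtain ⟨a0, a1, h0, h1, rfl⟩ := exists_twMk α
  refine (quotRangeMk_mem_coboundaries φ (sub_add_cancel m 1) _).2
    ⟨-integral B (sub_add_cancel m 1) a1, a0, ?_⟩
  refine (integral_d B hm (sub_add_cancel m 1) a1).trans ?_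
  rw [h0, h1, map_neg]
  abel

/-- If `∫ω₁ = dz + φ(a)`, the antiderivative of `ω₁` ends at `dz + φ(a)`; subtracting `d(tz)` makes
it end at `φ(a)`. That `da = ω₀` may be checked after applying the injective `φ`. -/
lemma mem_coboundaries_of_twIntegralMk (hφ : IsInclusion φ) (ω : (TW φ).X n)
    (hω : ω ∈ (TW φ).cocycles n) (h : twIntegralMk φ hm ω ∈ (quotRange φ).coboundaries m) :
    ω ∈ (TW φ).coboundaries n := by
  obtain ⟨w0, w1, h0, h1, rfl⟩ := exists_twMk ω
  obtain ⟨-, hd⟩ := (d_twMk_eq_zero_iff _).1 ((DGVect.mem_cocycles rfl _).1 hω)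
  obtain ⟨z, a, e⟩ := (quotRangeMk_mem_coboundaries φ (sub_add_cancel m 1) _).1 h
  have hK := d_formsAnti B hm rfl hd h0
  have e1 : (ev 1 B).f m (formsAnti B hm w1) = B.d (sub_add_cancel m 1) z + φ.f m a :=
    (ev_one_formsAnti B hm w1).trans e
  refine (DGVect.mem_coboundaries hm _).2 ⟨twMk φ a
    (formsAnti B hm w1 - (forms B).d (sub_add_cancel m 1) (timesT B _ z)) ?_ ?_,
    (d_twMk_eq_iff hm).2 ⟨hφ n ?_, ?_⟩⟩
  · rw [map_sub, ev_zero_formsAnti, Hom.comm_d, ev_zero_timesT, map_zero, sub_zero]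
  · rw [map_sub, e1, Hom.comm_d, ev_one_timesT, add_sub_cancel_left]
  · have := congrArg (B.d hm) e1
    rw [map_add, B.d_d, zero_add, ← Hom.comm_d, hK, h1] at this
    rw [Hom.comm_d, this]
  · rw [map_sub, hK, (forms B).d_d, sub_zero]

/-- A relative cocycle `x` with `dx = φ(a)` is the integral of the cocycle `(a, d(tx))`. -/
lemma exists_twIntegralMk_eq (hφ : IsInclusion φ) (y : (quotRange φ).X m)
    (hy : y ∈ (quotRange φ).cocycles m) : ∃ ω ∈ (TW φ).cocycles n, twIntegralMk φ hm ω = y := by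
  obtain ⟨x, rfl⟩ := quotRangeMk_surjective φ m y
  obtain ⟨a, ha⟩ := (quotRangeMk_mem_cocycles φ hm x).1 hy
  refine ⟨twMk φ a ((forms B).d hm (timesT B m x)) ?_ ?_, ?_, ?_⟩
  · rw [Hom.comm_d, ev_zero_timesT, map_zero]
  · rw [Hom.comm_d, ev_one_timesT, ha]
  · refine (DGVect.mem_cocycles rfl _).2 ((d_twMk_eq_zero_iff rfl).2 ⟨hφ _ ?_, (forms B).d_d _ _ _⟩)
    rw [Hom.comm_d, ha, B.d_d, map_zero]
  · rw [twIntegralMk_twMk, integral_d_timesT]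

/-- The isomorphism `H^n(TW(φ)) ≅ H^(n-1)(B / φ(A))` induced by integration. -/
noncomputable def twIntegralEquiv (hφ : IsInclusion φ) : (TW φ).H n ≃ₗ[K] (quotRange φ).H m :=
  LinearEquiv.ofBijective
    (DGVect.mapH (twIntegralMk φ hm) (twIntegralMk_mem_cocycles φ hm)
      (twIntegralMk_mem_coboundaries φ hm))
    (DGVect.bijective_of_represents _ (twIntegralMk φ hm)
      (fun _ _ => DGVect.mapH_represents _ _ _) (mem_coboundaries_of_twIntegralMk φ hm hφ)
      (fun y hy => by
        obtain ⟨ω, hω, rfl⟩ := exists_twIntegralMk_eq φ hm hφ y hy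
        exact ⟨ω, hω, by rw [sub_self]; exact zero_mem _⟩))

lemma twIntegralEquiv_represents (hφ : IsInclusion φ) {a : (TW φ).H n} {ω : (TW φ).X n}
    (h : (TW φ).Represents a ω) :
    (quotRange φ).Represents (twIntegralEquiv φ hm hφ a)
      (quotRangeMk φ m (twIntegral φ hm ω)) :=
  DGVect.mapH_represents (twIntegralMk φ hm) (twIntegralMk_mem_cocycles φ hm)
    (twIntegralMk_mem_coboundaries φ hm) h

end

end DGLA

namespace DGLA

variable {K : Type u} [Field K]

/-! ### The cohomology of the double homotopy fiber of a fiber product -/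

section

variable (S : Square K) {n m k : ℤ} (hm : m + 1 = n) (hk : k + 1 = m)

lemma Square.h1_v0 {n : ℤ} (x : S.A00.X n) : S.h1.f n (S.v0.f n x) = S.v1.f n (S.h0.f n x) :=
  (congr_f S.comm n x).symm

variable {S} in
lemma Square.IsFiberProduct.ext (hS : S.IsFiberProduct) {n : ℤ} {x x' : S.A00.X n}
    (hv : S.v0.f n x = S.v0.f n x') (hh : S.h0.f n x = S.h0.f n x') : x = x' :=
  (hS n _ _ (S.h1_v0 x')).unique ⟨hv, hh⟩ ⟨rfl, rfl⟩

/-- The map `(ω₀₀, ω₁₀, ω₀₁, ω₁₁) ↦ ∫_{Δ¹ × Δ¹} ω₁₁` to `A₁₁ / (A₁₀ + A₀₁)`, as a linear map. -/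
noncomputable def tw2IntegralMk : (TW2 S).X n →ₗ[K] (quotSum S.h1 S.v1).X k :=
  quotSumMk S.h1 S.v1 k ∘ₗ integral S.A11 hk ∘ₗ integral (forms S.A11) hm ∘ₗ
    LinearMap.snd K ((forms S.A01).X n) ((forms (forms S.A11)).X n) ∘ₗ
    LinearMap.snd K ((forms S.A10).X n) ((forms S.A01).X n × (forms (forms S.A11)).X n) ∘ₗ
    LinearMap.snd K (S.A00.X n)
      ((forms S.A10).X n × (forms S.A01).X n × (forms (forms S.A11)).X n) ∘ₗ
    (S.tw2Sub n).subtype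

lemma tw2IntegralMk_tw2Mk {w00 : S.A00.X n} {w10 : (forms S.A10).X n}
    {w01 : (forms S.A01).X n} {w11 : (forms (forms S.A11)).X n} {hw} :
    tw2IntegralMk S hm hk (tw2Mk S w00 w10 w01 w11 hw) =
      quotSumMk S.h1 S.v1 k (integral S.A11 hk (integral (forms S.A11) hm w11)) := rfl

variable [CharZero K]

variable {S} in
/-- Stokes' formula for the double integral. -/
lemma Square.IsTW2.integral_integral_d {w00 : S.A00.X m} {w10 : (forms S.A10).X m}
    {w01 : (forms S.A01).X m} {w11 : (forms (forms S.A11)).X m} (hw : S.IsTW2 w00 w10 w01 w11)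
    {l : ℤ} (hl : l + 1 = k) :
    integral S.A11 hk (integral (forms S.A11) hm ((forms (forms S.A11)).d hm w11)) =
      S.A11.d hl (integral S.A11 hl (integral (forms S.A11) hk w11)) +
      S.h1.f k (integral S.A10 hk w10) + S.v1.f k (-integral S.A01 hk w01) := by
  rw [integral_d _ hm hk, hw.w11_bot, hw.w11_top, sub_zero, map_sub, integral_d _ hk hl,
    ← integral_formsMap, ← integral_formsMap, hw.w11_left, hw.w11_right, map_zero, sub_zero,
    integral_formsMap, integral_formsMap, map_neg]
  abel

lemma tw2IntegralMk_mem_coboundaries (ω : (TW2 S).X n) (hω : ω ∈ (TW2 S).coboundaries n) :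
    tw2IntegralMk S hm hk ω ∈ (quotSum S.h1 S.v1).coboundaries k := by
  obtain ⟨α, rfl⟩ := (DGVect.mem_coboundaries hm _).1 hω
  obtain ⟨a00, a10, a01, a11, ha, rfl⟩ := exists_tw2Mk α
  exact (quotSumMk_mem_coboundaries _ _ (sub_add_cancel k 1) _).2
    ⟨_, _, _, ha.integral_integral_d hm hk (sub_add_cancel k 1)⟩

lemma tw2IntegralMk_mem_cocycles (ω : (TW2 S).X n) (hω : ω ∈ (TW2 S).cocycles n) :
    tw2IntegralMk S hm hk ω ∈ (quotSum S.h1 S.v1).cocycles k := by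
  obtain ⟨w00, w10, w01, w11, hw, rfl⟩ := exists_tw2Mk ω
  obtain ⟨-, -, -, hd⟩ := (d_tw2Mk_eq_zero_iff rfl).1 ((DGVect.mem_cocycles rfl _).1 hω)
  have e := hw.integral_integral_d rfl hm hk
  rw [hd, map_zero, map_zero] at e
  rw [tw2IntegralMk_tw2Mk]
  refine (quotSumMk_mem_cocycles _ _ hk _).2
    ⟨-integral S.A10 hm w10, integral S.A01 hm w01, ?_⟩
  rw [map_neg] at e ⊢
  rw [eq_neg_add_iff_add_eq, ← sub_eq_zero, e]
  abel

/-- The antiderivatives of the components, corrected by exact forms `d(t ·)` so that the boundary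
conditions match. The corrections `u`, `w`, `z` come from `∫∫ω₁₁ = dz + h₁(u) + v₁(w)`. -/
lemma mem_coboundaries_of_tw2IntegralMk (hS : S.IsFiberProduct) (ω : (TW2 S).X n)
    (hω : ω ∈ (TW2 S).cocycles n)
    (h : tw2IntegralMk S hm hk ω ∈ (quotSum S.h1 S.v1).coboundaries k) :
    ω ∈ (TW2 S).coboundaries n := by
  obtain ⟨w00, w10, w01, w11, hw, rfl⟩ := exists_tw2Mk ω
  obtain ⟨-, hd10, hd01, hd11⟩ := (d_tw2Mk_eq_zero_iff rfl).1 ((DGVect.mem_cocycles rfl _).1 hω)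
  obtain ⟨z, u, w, e⟩ := (quotSumMk_mem_coboundaries _ _ (sub_add_cancel k 1) _).1 h
  have k10 := d_formsAnti _ hm rfl hd10 hw.w10_zero
  have k01 := d_formsAnti _ hm rfl hd01 hw.w01_zero
  have k11 := d_formsAnti _ hm rfl hd11 hw.w11_bot
  -- The integral along `t₁`: a form in `t₀`, and the value at `t₁ = 1` of the antiderivative of
  -- `ω₁₁`.
  set η := integral (forms S.A11) hm w11 with hη
  have η0 : (ev 0 S.A11).f m η = 0 := by
    rw [hη, ← integral_formsMap, hw.w11_left, map_zero]
  have η1 : (ev 1 S.A11).f m η = S.v1.f m (integral S.A01 hm w01) := by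
    rw [hη, ← integral_formsMap, hw.w11_right, integral_formsMap]
  have dη : (forms S.A11).d hm η = (formsMap S.h1).f n w10 := by
    rw [hη, ← ev_one_formsAnti, ← Hom.comm_d, k11, hw.w11_top]
  -- The difference of `η` and the antiderivative of `ω₁₀` is closed and zero at `t₀ = 0`. Its own
  -- antiderivative is that of `η` alone, because the antiderivative squares to zero.
  have hη' : η = (formsMap S.h1).f m (formsAnti S.A10 hm w10) +
      (forms S.A11).d hk (formsAnti S.A11 hk η) := by
    have := d_formsAnti S.A11 hk hm
      (ω := η - (formsMap S.h1).f m (formsAnti S.A10 hm w10))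
      (by rw [map_sub, ← Hom.comm_d, k10, dη, sub_self])
      (by rw [map_sub, η0, ev_naturality, ev_zero_formsAnti, map_zero, sub_zero])
    rw [map_sub, ← formsMap_formsAnti, formsAnti_formsAnti, map_zero, sub_zero] at this
    rw [this, add_sub_cancel]
  have e1 : (ev 1 S.A11).f k (formsAnti S.A11 hk η) = _ := (ev_one_formsAnti _ _ _).trans e
  -- Evaluation of `hη'` at `t₀ = 1`. This is the compatibility that the fiber product needs to
  -- provide the component in `A₀₀`.
  have e2 : S.h1.f m (integral S.A10 hm w10 + S.A10.d hk u) =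
      S.v1.f m (integral S.A01 hm w01 - S.A01.d hk w) := by
    have := congrArg ((ev 1 S.A11).f m) hη'
    rw [η1, map_add, Hom.comm_d, e1, ev_naturality, ev_one_formsAnti, map_add, map_add,
      S.A11.d_d, zero_add] at this
    rw [map_add, map_sub, this, Hom.comm_d, Hom.comm_d]
    abel
  obtain ⟨a, ⟨ha, ha'⟩, -⟩ := hS m _ _ e2
  -- Adding `d(t₁θ)` to the antiderivative of `ω₁₁` adds `dθ` at `t₁ = 1` and `d(t₁θ(1))` at `t₀ =
  -- 1`. So `θ` must satisfy `θ(0) = 0`, `θ(1) = -v₁(w)` and `η + dθ = h₁(∫₀ᵗω₁₀ + d(tu))`.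
  set θ := (forms S.A11).d (sub_add_cancel k 1) (timesT S.A11 _ z) +
    timesT S.A11 k (S.h1.f k u) - formsAnti S.A11 hk η with hθ
  have θ0 : (ev 0 S.A11).f k θ = 0 := by
    rw [hθ, map_sub, map_add, Hom.comm_d, ev_zero_timesT, ev_zero_timesT, ev_zero_formsAnti,
      map_zero, add_zero, sub_zero]
  have θ1 : (ev 1 S.A11).f k θ = -S.v1.f k w := by
    rw [hθ, map_sub, map_add, Hom.comm_d, ev_one_timesT, ev_one_timesT, e1]
    abel
  have dθ : (forms S.A11).d hk θ = (formsMap S.h1).f m (formsAnti S.A10 hm w10) +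
      (forms S.A11).d hk (timesT S.A11 k (S.h1.f k u)) - η := by
    rw [hθ, map_sub, map_add, (forms S.A11).d_d, zero_add]
    conv_rhs => rw [hη']
    abel
  refine (DGVect.mem_coboundaries hm _).2 ⟨tw2Mk S a
    (formsAnti S.A10 hm w10 + (forms S.A10).d hk (timesT S.A10 k u))
    (formsAnti S.A01 hm w01 - (forms S.A01).d hk (timesT S.A01 k w))
    (formsAnti (forms S.A11) hm w11 + (forms (forms S.A11)).d hk (timesT (forms S.A11) k θ))
    ⟨?_, ?_, ?_, ?_, ?_, ?_, ?_, ?_⟩, (d_tw2Mk_eq_iff hm).2 ⟨?_, ?_, ?_, ?_⟩⟩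
  · rw [map_add, ev_zero_formsAnti, Hom.comm_d, ev_zero_timesT, map_zero, add_zero]
  · rw [map_add, ev_one_formsAnti, Hom.comm_d, ev_one_timesT, ha]
  · rw [map_sub, ev_zero_formsAnti, Hom.comm_d, ev_zero_timesT, map_zero, sub_zero]
  · rw [map_sub, ev_one_formsAnti, Hom.comm_d, ev_one_timesT, ha']
  · rw [map_add, formsMap_formsAnti, Hom.comm_d, formsMap_timesT, hw.w11_left, θ0, map_zero,
      map_zero, map_zero, add_zero]
  · rw [map_add, formsMap_formsAnti, Hom.comm_d, formsMap_timesT, hw.w11_right, θ1, map_sub,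
      formsMap_formsAnti, Hom.comm_d, formsMap_timesT, map_neg, map_neg, sub_eq_add_neg]
  · rw [map_add, ev_zero_formsAnti, Hom.comm_d, ev_zero_timesT, map_zero, add_zero]
  · rw [map_add, ev_one_formsAnti, Hom.comm_d, ev_one_timesT, dθ, map_add, Hom.comm_d,
      formsMap_timesT, ← hη]
    abel
  -- By uniqueness in the fiber product, `da = ω₀₀` is checked in `A₁₀` and in `A₀₁`, at the
  -- endpoints of the antiderivatives.
  · have hv : S.v0.f n (S.A00.d hm a) = S.v0.f n w00 := by
      rw [Hom.comm_d, ha, map_add, S.A10.d_d, add_zero, ← ev_one_formsAnti, ← Hom.comm_d, k10,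
        hw.w10_one]
    refine hS.ext hv ?_
    rw [Hom.comm_d, ha', map_sub, S.A01.d_d, sub_zero, ← ev_one_formsAnti, ← Hom.comm_d, k01,
      hw.w01_one]
  · rw [map_add, k10, (forms S.A10).d_d, add_zero]
  · rw [map_sub, k01, (forms S.A01).d_d, sub_zero]
  · rw [map_add, k11, (forms (forms S.A11)).d_d, add_zero]

/-- From `dy = h₁(u) + v₁(w)` follows `h₁(-du) = v₁(dw)`, which yields the component in `A₀₀`; the
other components are exact forms of type `d(t ·)`. -/
lemma exists_tw2IntegralMk_eq (hS : S.IsFiberProduct) (y : (quotSum S.h1 S.v1).X k)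
    (hy : y ∈ (quotSum S.h1 S.v1).cocycles k) :
    ∃ ω ∈ (TW2 S).cocycles n, tw2IntegralMk S hm hk ω = y := by
  obtain ⟨y, rfl⟩ := quotSumMk_surjective S.h1 S.v1 k y
  obtain ⟨u, w, e⟩ := (quotSumMk_mem_cocycles _ _ hk y).1 hy
  have e' : S.h1.f n (-S.A10.d hm u) = S.v1.f n (S.A01.d hm w) := by
    have := congrArg (S.A11.d hm) e
    rw [S.A11.d_d, map_add, ← Hom.comm_d, ← Hom.comm_d, eq_comm, add_eq_zero_iff_neg_eq] at this
    rw [map_neg, this]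
  obtain ⟨a, ⟨ha, ha'⟩, -⟩ := hS n _ _ e'
  -- The term `d(ty)` gives the integral `y`; the term `t h₁(u)` has integral `0` and changes the
  -- endpoint from `dy` to `v₁(w)`.
  set η := (forms S.A11).d hk (timesT S.A11 k y) - timesT S.A11 m (S.h1.f m u) with hη
  have η0 : (ev 0 S.A11).f m η = 0 := by
    rw [hη, map_sub, Hom.comm_d, ev_zero_timesT, ev_zero_timesT, map_zero, sub_zero]
  have η1 : (ev 1 S.A11).f m η = S.v1.f m w := by
    rw [hη, map_sub, Hom.comm_d, ev_one_timesT, ev_one_timesT, e]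
    abel
  refine ⟨tw2Mk S a (-(forms S.A10).d hm (timesT S.A10 m u))
    ((forms S.A01).d hm (timesT S.A01 m w))
    ((forms (forms S.A11)).d hm (timesT (forms S.A11) m η))
    ⟨?_, ?_, ?_, ?_, ?_, ?_, ?_, ?_⟩,
    (DGVect.mem_cocycles rfl _).2 ((d_tw2Mk_eq_zero_iff rfl).2 ⟨hS.ext ?_ ?_, ?_, ?_, ?_⟩), ?_⟩
  · rw [map_neg, Hom.comm_d, ev_zero_timesT, map_zero, neg_zero]
  · rw [map_neg, Hom.comm_d, ev_one_timesT, ha]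
  · rw [Hom.comm_d, ev_zero_timesT, map_zero]
  · rw [Hom.comm_d, ev_one_timesT, ha']
  · rw [Hom.comm_d, formsMap_timesT, η0, map_zero, map_zero]
  · rw [Hom.comm_d, formsMap_timesT, η1, Hom.comm_d, formsMap_timesT]
  · rw [Hom.comm_d, ev_zero_timesT, map_zero]
  · rw [Hom.comm_d, ev_one_timesT, hη, map_sub, (forms S.A11).d_d, map_neg, Hom.comm_d,
      formsMap_timesT, zero_sub]
  · rw [Hom.comm_d, ha, map_neg, S.A10.d_d, map_zero, neg_zero]
  · rw [Hom.comm_d, ha', S.A01.d_d, map_zero]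
  · rw [map_neg, (forms S.A10).d_d, neg_zero]
  · exact (forms S.A01).d_d _ _ _
  · exact (forms (forms S.A11)).d_d _ _ _
  · rw [tw2IntegralMk_tw2Mk, integral_d_timesT, hη, map_sub, integral_d_timesT, integral_timesT,
      sub_zero]

/-- The isomorphism `H^n(TW^[2]) ≅ H^(n-2)(A₁₁ / (A₁₀ + A₀₁))` induced by integration, for a fiber
product. -/
noncomputable def tw2IntegralEquiv (hS : S.IsFiberProduct) :
    (TW2 S).H n ≃ₗ[K] (quotSum S.h1 S.v1).H k :=
  LinearEquiv.ofBijective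
    (DGVect.mapH (tw2IntegralMk S hm hk) (tw2IntegralMk_mem_cocycles S hm hk)
      (tw2IntegralMk_mem_coboundaries S hm hk))
    (DGVect.bijective_of_represents _ (tw2IntegralMk S hm hk)
      (fun _ _ => DGVect.mapH_represents _ _ _) (mem_coboundaries_of_tw2IntegralMk S hm hk hS)
      (fun y hy => by
        obtain ⟨ω, hω, rfl⟩ := exists_tw2IntegralMk_eq S hm hk hS y hy
        exact ⟨ω, hω, by rw [sub_self]; exact zero_mem _⟩))

lemma tw2IntegralEquiv_represents (hS : S.IsFiberProduct) {b : (TW2 S).H n} {ω : (TW2 S).X n}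
    (h : (TW2 S).Represents b ω) :
    (quotSum S.h1 S.v1).Represents (tw2IntegralEquiv S hm hk hS b)
      (quotSumMk S.h1 S.v1 k (tw2Integral S hm hk ω)) :=
  DGVect.mapH_represents (tw2IntegralMk S hm hk) (tw2IntegralMk_mem_cocycles S hm hk)
    (tw2IntegralMk_mem_coboundaries S hm hk) h

end

/-! ### The projection `TW^[2] ⟶ TW` when the lower row of the square is acyclic -/

section

variable [CharZero K] (S : Square K) {n m : ℤ} (hm : m + 1 = n)

/-- Every cocycle is a coboundary. -/
def IsAcyclic (A : DGLA K) : Prop :=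
  ∀ {i j k : ℤ} (hij : i + 1 = j) (hjk : j + 1 = k) (x : A.X j), A.d hjk x = 0 →
    ∃ y, A.d hij y = x

/-- A primitive `(b₀, b₁)` of the projection extends to one of `ω`. Acyclicity is used twice, to
match an endpoint in `A₁₀` and one in `A₁₁`. -/
lemma mem_coboundaries_of_tw2Proj (h10 : IsAcyclic S.A10) (h11 : IsAcyclic S.A11)
    (ω : (TW2 S).X n) (hω : ω ∈ (TW2 S).cocycles n)
    (h : (tw2Proj S).f n ω ∈ (TW S.h0).coboundaries n) : ω ∈ (TW2 S).coboundaries n := by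
  obtain ⟨w00, w10, w01, w11, hw, rfl⟩ := exists_tw2Mk ω
  obtain ⟨-, hd10, hd01, hd11⟩ := (d_tw2Mk_eq_zero_iff rfl).1 ((DGVect.mem_cocycles rfl _).1 hω)
  obtain ⟨m, hm⟩ : ∃ m, m + 1 = n := ⟨n - 1, sub_add_cancel n 1⟩
  obtain ⟨β, e⟩ := (DGVect.mem_coboundaries hm _).1 h
  rw [tw2Proj_tw2Mk] at e
  obtain ⟨b0, b1, hb0, hb1, rfl⟩ := exists_twMk β
  obtain ⟨db0, db1⟩ := (d_twMk_eq_iff hm).1 e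
  have k10 := d_formsAnti _ hm rfl hd10 hw.w10_zero
  have k01 := d_formsAnti _ hm rfl hd01 hw.w01_zero
  have k11 := d_formsAnti _ hm rfl hd11 hw.w11_bot
  obtain ⟨k, hk⟩ : ∃ k, k + 1 = m := ⟨m - 1, sub_add_cancel m 1⟩
  -- Both `v₀(b₀)` and `∫ω₁₀` have differential `v₀(ω₀₀)`. Their difference is the endpoint error of
  -- the antiderivative of `ω₁₀`, and `d(tp)` removes it.
  obtain ⟨p, hp⟩ := h10 hk hm (S.v0.f m b0 - integral S.A10 hm w10) (by
    rw [map_sub, ← Hom.comm_d, db0, ← ev_one_formsAnti, ← Hom.comm_d, k10, hw.w10_one, sub_self])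
  -- The form `b₁` enters only through its integral: the new component over `A₀₁` is the
  -- antiderivative of `ω₀₁` plus `d(tq)`, a shape compatible with the antiderivative of `ω₁₁` along
  -- `t₀ = 1`.
  set q := integral S.A01 hk b1 with hq
  have dq : S.A01.d hk q = S.h0.f m b0 - integral S.A01 hm w01 := by
    rw [← db1, integral_d _ hm hk, hb1, hb0, hq]
    abel
  set η := integral (forms S.A11) hm w11 with hη
  have η0 : (ev 0 S.A11).f m η = 0 := by
    rw [hη, ← integral_formsMap, hw.w11_left, map_zero]
  have η1 : (ev 1 S.A11).f m η = S.v1.f m (integral S.A01 hm w01) := by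
    rw [hη, ← integral_formsMap, hw.w11_right, integral_formsMap]
  have dη : (forms S.A11).d hm η = (formsMap S.h1).f n w10 := by
    rw [hη, ← ev_one_formsAnti, ← Hom.comm_d, k11, hw.w11_top]
  set a10 := formsAnti S.A10 hm w10 + (forms S.A10).d hk (timesT S.A10 k p) with ha10
  have a10_0 : (ev 0 S.A10).f m a10 = 0 := by
    rw [ha10, map_add, ev_zero_formsAnti, Hom.comm_d, ev_zero_timesT, map_zero, add_zero]
  have a10_1 : (ev 1 S.A10).f m a10 = S.v0.f m b0 := by
    rw [ha10, map_add, ev_one_formsAnti, Hom.comm_d, ev_one_timesT, hp, add_sub_cancel]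
  have da10 : (forms S.A10).d hm a10 = w10 := by
    rw [ha10, map_add, k10, (forms S.A10).d_d, add_zero]
  have hE := d_formsAnti S.A11 hk hm (ω := (formsMap S.h1).f m a10 - η)
    (by rw [map_sub, ← Hom.comm_d, da10, dη, sub_self])
    (by rw [map_sub, ev_naturality, a10_0, η0, map_zero, sub_zero])
  set E := formsAnti S.A11 hk ((formsMap S.h1).f m a10 - η) with hE'
  -- `E` already solves `dE = h₁(a₁₀) - η` with `E(0) = 0`. Its endpoint differs from the required
  -- `v₁(q)` by a cocycle, hence by some `dz`, and `d(tz)` absorbs it.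
  obtain ⟨z, hz⟩ := h11 (sub_add_cancel k 1) hk (S.v1.f k q - (ev 1 S.A11).f k E) (by
    rw [map_sub, ← Hom.comm_d, ← Hom.comm_d, hE, dq, map_sub, map_sub, ev_naturality, a10_1, η1,
      S.h1_v0, sub_self])
  set θ := E + (forms S.A11).d (sub_add_cancel k 1) (timesT S.A11 _ z) with hθ
  have θ0 : (ev 0 S.A11).f k θ = 0 := by
    rw [hθ, map_add, hE', ev_zero_formsAnti, Hom.comm_d, ev_zero_timesT, map_zero, add_zero]
  have θ1 : (ev 1 S.A11).f k θ = S.v1.f k q := by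
    rw [hθ, map_add, Hom.comm_d, ev_one_timesT, hz, add_sub_cancel]
  have dθ : (forms S.A11).d hk θ = (formsMap S.h1).f m a10 - η := by
    rw [hθ, map_add, (forms S.A11).d_d, hE, add_zero]
  refine (DGVect.mem_coboundaries hm _).2 ⟨tw2Mk S b0 a10
    (formsAnti S.A01 hm w01 + (forms S.A01).d hk (timesT S.A01 k q))
    (formsAnti (forms S.A11) hm w11 + (forms (forms S.A11)).d hk (timesT (forms S.A11) k θ))
    ⟨a10_0, a10_1, ?_, ?_, ?_, ?_, ?_, ?_⟩, (d_tw2Mk_eq_iff hm).2 ⟨db0, da10, ?_, ?_⟩⟩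
  · rw [map_add, ev_zero_formsAnti, Hom.comm_d, ev_zero_timesT, map_zero, add_zero]
  · rw [map_add, ev_one_formsAnti, Hom.comm_d, ev_one_timesT, dq, add_sub_cancel]
  · rw [map_add, formsMap_formsAnti, Hom.comm_d, formsMap_timesT, hw.w11_left, θ0, map_zero,
      map_zero, map_zero, add_zero]
  · rw [map_add, formsMap_formsAnti, Hom.comm_d, formsMap_timesT, hw.w11_right, θ1, map_add,
      formsMap_formsAnti, Hom.comm_d, formsMap_timesT]
  · rw [map_add, ev_zero_formsAnti, Hom.comm_d, ev_zero_timesT, map_zero, add_zero]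
  · rw [map_add, ev_one_formsAnti, Hom.comm_d, ev_one_timesT, dθ, ← hη, add_sub_cancel]
  · rw [map_add, k01, (forms S.A01).d_d, add_zero]
  · rw [map_add, k11, (forms (forms S.A11)).d_d, add_zero]

/-- A cocycle `(ω₀₀, ω₀₁)` of `TW(A0•)` is cohomologous to the projection of a cocycle of `TW^[2]`
whose double integral is any `z` with `dz = ∫ω₀₁ - p` in `A₁₁`, where `dp = ω₀₀` in `A₁₀`. -/
lemma exists_tw2Proj_sub_mem {k : ℤ} (hk : k + 1 = m) {w00 : S.A00.X n} {w01 : (forms S.A01).X n}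
    {h0 h1} (hω : twMk S.h0 w00 w01 h0 h1 ∈ (TW S.h0).cocycles n) {p : S.A10.X m}
    (hp : S.A10.d hm p = S.v0.f n w00) {z : S.A11.X k}
    (hz : S.A11.d hk z = S.v1.f m (integral S.A01 hm w01) - S.h1.f m p) :
    ∃ σ ∈ (TW2 S).cocycles n, tw2Integral S hm hk σ = z ∧
      (tw2Proj S).f n σ - twMk S.h0 w00 w01 h0 h1 ∈ (TW S.h0).coboundaries n := by
  obtain ⟨hd00, hd01⟩ := (d_twMk_eq_zero_iff rfl).1 ((DGVect.mem_cocycles rfl _).1 hω)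
  have k01 := d_formsAnti _ hm rfl hd01 h0
  -- The lift projects to `(ω₀₀, d(tq))`. As `tq` and the antiderivative of `ω₀₁` have the same
  -- endpoint `q`, this differs from `(ω₀₀, ω₀₁)` by the coboundary of `(0, tq - ∫₀ᵗω₀₁)`.
  set q := integral S.A01 hm w01 with hq
  have dq : S.A01.d hm q = S.h0.f n w00 := by
    rw [hq, ← ev_one_formsAnti, ← Hom.comm_d, k01, h1]
  -- Here `η(1) = h₁(p) + dz = v₁(q)`, `dη = h₁(d(tp))` and `∫η = z`: the two boundary conditions
  -- and the double integral of `d(t₁η)`.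
  set η := timesT S.A11 m (S.h1.f m p) + (forms S.A11).d hk (timesT S.A11 k z) with hη
  have η0 : (ev 0 S.A11).f m η = 0 := by
    rw [hη, map_add, Hom.comm_d, ev_zero_timesT, ev_zero_timesT, map_zero, add_zero]
  have η1 : (ev 1 S.A11).f m η = S.v1.f m q := by
    rw [hη, map_add, Hom.comm_d, ev_one_timesT, ev_one_timesT, hz, add_sub_cancel]
  have hσ : S.IsTW2 w00 ((forms S.A10).d hm (timesT S.A10 m p))
      ((forms S.A01).d hm (timesT S.A01 m q))
      ((forms (forms S.A11)).d hm (timesT (forms S.A11) m η)) := by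
    refine ⟨?_, ?_, ?_, ?_, ?_, ?_, ?_, ?_⟩
    · rw [Hom.comm_d, ev_zero_timesT, map_zero]
    · rw [Hom.comm_d, ev_one_timesT, hp]
    · rw [Hom.comm_d, ev_zero_timesT, map_zero]
    · rw [Hom.comm_d, ev_one_timesT, dq]
    · rw [Hom.comm_d, formsMap_timesT, η0, map_zero, map_zero]
    · rw [Hom.comm_d, formsMap_timesT, η1, Hom.comm_d, formsMap_timesT]
    · rw [Hom.comm_d, ev_zero_timesT, map_zero]
    · rw [Hom.comm_d, ev_one_timesT, hη, map_add, (forms S.A11).d_d, Hom.comm_d,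
        formsMap_timesT, add_zero]
  refine ⟨tw2Mk S _ _ _ _ hσ, (DGVect.mem_cocycles rfl _).2 ((d_tw2Mk_eq_zero_iff rfl).2
    ⟨hd00, (forms _).d_d _ _ _, (forms _).d_d _ _ _, (forms _).d_d _ _ _⟩), ?_,
    (DGVect.mem_coboundaries hm _).2 ⟨twMk S.h0 0 (timesT S.A01 m q - formsAnti S.A01 hm w01) ?_ ?_,
    ?_⟩⟩
  · rw [tw2Integral_tw2Mk, integral_d_timesT, hη, map_add, integral_d_timesT, integral_timesT,
      zero_add]
  · rw [map_sub, ev_zero_timesT, ev_zero_formsAnti, sub_zero]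
  · rw [map_sub, ev_one_timesT, ev_one_formsAnti, map_zero, sub_self]
  · rw [tw2Proj_tw2Mk, twMk_sub, d_twMk_eq_iff]
    rw [map_zero, sub_self, map_sub, k01]
    exact ⟨rfl, rfl⟩

end

end DGLA

/-! ### The operator `♭` and the acyclicity of the cone -/

namespace DGLA

variable {K : Type u} [Field K]

lemma d_flat (g : DGLA K) {k m n : ℤ} (hk : k + 1 = m) (hm : m + 1 = n) (x : g.X m) :
    (cone g).d hk (flat g hk x) = (coneIncl g).f m x - flat g hm (g.d hm x) := by
  subst hk hm
  show ((g.d rfl 0 + x, -g.d rfl x) : g.X (k + 1) × g.X (k + 1 + 1)) =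
    (x, 0) - (0, g.d rfl x)
  rw [map_zero, zero_add, Prod.mk_sub_mk, sub_zero, zero_sub]

lemma coneMap_flat {A B : DGLA K} (φ : A ⟶ B) {k m : ℤ} (hk : k + 1 = m) (x : A.X m) :
    (coneMap φ).f k (flat A hk x) = flat B hk (φ.f m x) := by
  subst hk
  exact Prod.ext (φ.f k).map_zero rfl

/-- `♭` is a contraction: if `x + ♭y` is a cocycle then `dx = -y`, so `d♭x = x - ♭dx = x + ♭y`. -/
lemma cone_isAcyclic (g : DGLA K) : IsAcyclic (cone g) := by
  intro i j k hij hjk x hx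
  subst hij hjk
  obtain ⟨a, b⟩ := x
  have e : g.d rfl a + b = 0 := congrArg Prod.fst hx
  refine ⟨flat g rfl a, (d_flat g rfl rfl a).trans ?_⟩
  exact Prod.ext (sub_zero a) ((zero_sub _).trans (neg_eq_of_add_eq_zero_right e))

end DGLA

/-! ### Cartan's formula and the map induced by the Cartan homotopy -/

namespace CartanCalculus

variable {K : Type u} [Field K]

/-- Cartan's formula `d i_x = χ(h(x)) - i_{dx}`. -/
lemma d_i (C : CartanCalculus K) {k m n : ℤ} (hk : k + 1 = m) (hm : m + 1 = n) (x : C.g00.X m) :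
    C.g11.d hk (C.i hk x) = C.χ.f m (C.h.f m x) - C.i hm (C.g00.d hm x) := by
  refine (C.c.comm_d hk _).symm.trans ?_
  rw [d_flat _ hk hm, map_sub]
  exact congrArg (· - _) (congr_f C.comm m x).symm

namespace Morphism

variable {C₀ C₁ : CartanCalculus K} (F : Morphism C₀ C₁)

lemma i_f00 {k m : ℤ} (hk : k + 1 = m) (x : C₀.g00.X m) :
    C₁.i hk (F.f00.f m x) = F.f11.f k (C₀.i hk x) := by
  refine (congrArg (C₁.c.f k) (coneMap_flat F.f00 hk x)).symm.trans ?_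
  exact (congr_f F.comm_c k (flat C₀.g00 hk x)).symm

/-- The map `g001 / g000 ⟶ g111 / (g110 + g101)` of degree `-1` induced by the Cartan homotopy. -/
def iQuot {k m : ℤ} (hk : k + 1 = m) :
    (quotRange F.f00).X m →ₗ[K] (quotSum F.f11 C₁.χ).X k :=
  Submodule.mapQ (LinearMap.range (F.f00.f m))
    (LinearMap.range (F.f11.f k) ⊔ LinearMap.range (C₁.χ.f k)) (C₁.i hk) (by
      rintro _ ⟨x, rfl⟩
      exact Submodule.mem_sup_left ⟨_, (F.i_f00 hk x).symm⟩)

lemma iQuot_mk {k m : ℤ} (hk : k + 1 = m) (x : C₁.g00.X m) :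
    F.iQuot hk (quotRangeMk F.f00 m x) = quotSumMk F.f11 C₁.χ k (C₁.i hk x) := rfl

/-- The map in cohomology induced by the Cartan homotopy. -/
def iH {k m : ℤ} (hk : k + 1 = m) : (quotRange F.f00).H m →ₗ[K] (quotSum F.f11 C₁.χ).H k :=
  DGVect.mapH (F.iQuot hk)
    (by
      intro x hx
      obtain ⟨x, rfl⟩ := quotRangeMk_surjective F.f00 m x
      obtain ⟨a, ha⟩ := (quotRangeMk_mem_cocycles F.f00 rfl x).1 hx
      rw [iQuot_mk, quotSumMk_mem_cocycles _ _ hk]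
      -- If `dx = φ(a)`, Cartan's formula reads `d i_x = χ(h(x)) - i_{φ(a)}`, and `i_{φ(a)}` comes
      -- from the source calculus.
      refine ⟨-C₀.i rfl a, C₁.h.f m x, ?_⟩
      rw [C₁.d_i hk rfl, ← ha, i_f00, map_neg]
      abel)
    (by
      intro x hx
      obtain ⟨x, rfl⟩ := quotRangeMk_surjective F.f00 m x
      obtain ⟨z, a, rfl⟩ := (quotRangeMk_mem_coboundaries F.f00 hk x).1 hx
      rw [iQuot_mk, quotSumMk_mem_coboundaries _ _ (sub_add_cancel k 1)]
      -- Cartan's formula for `z`: `i_{dz} = χ(h(z)) - d i_z`.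
      refine ⟨-C₁.i (sub_add_cancel k 1) z, C₀.i hk a, C₁.h.f k z, ?_⟩
      rw [map_add, i_f00, map_neg, C₁.d_i _ hk]
      abel)

lemma iH_represents {k m : ℤ} (hk : k + 1 = m) {x : (quotRange F.f00).H m} {x' : C₁.g00.X m}
    (h : (quotRange F.f00).Represents x (quotRangeMk F.f00 m x')) :
    (quotSum F.f11 C₁.χ).Represents (F.iH hk x) (quotSumMk F.f11 C₁.χ k (C₁.i hk x')) :=
  DGVect.mapH_represents (F.iQuot hk) _ _ h

variable [CharZero K]

/-- Every cocycle `ω` of `TW(g_{00•})` lifts, up to coboundaries, to a cocycle of the double homotopy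
fiber of the square of cones whose double integral is `♭ ∫ω`. -/
lemma exists_spanLeft_sub_mem {n m k : ℤ} (hm : m + 1 = n) (hk : k + 1 = m) (ω : (TW F.f00).X n)
    (hω : ω ∈ (TW F.f00).cocycles n) :
    ∃ σ ∈ (TW2 F.coneSquare).cocycles n,
      tw2Integral F.coneSquare hm hk σ = flat C₁.g00 hk (twIntegral F.f00 hm ω) ∧
      F.spanLeft.f n σ - ω ∈ (TW F.f00).coboundaries n := by
  obtain ⟨w0, w1, h0, h1, rfl⟩ := exists_twMk ω
  obtain ⟨hd0, hd1⟩ := (d_twMk_eq_zero_iff rfl).1 ((DGVect.mem_cocycles rfl _).1 hω)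
  -- Since `dω₀ = 0`, `d♭ω₀ = ω₀`; and `d♭∫ω₁ = ∫ω₁ - ♭d∫ω₁ = ∫ω₁ - ♭φ(ω₀)`, so `♭∫ω₁` is an
  -- admissible `z`.
  refine exists_tw2Proj_sub_mem F.coneSquare hm hk hω (p := flat C₀.g00 hm w0) ?_ ?_
  · refine (d_flat C₀.g00 hm rfl w0).trans ?_
    rw [hd0, map_zero, sub_zero]
    rfl
  · refine (d_flat C₁.g00 hk hm _).trans ?_
    refine congrArg ((coneIncl C₁.g00).f m (integral C₁.g00 hm w1) - ·) ?_
    refine Eq.trans ?_ (coneMap_flat F.f00 hm w0).symm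
    rw [twIntegral_twMk, ← h1, ← ev_one_formsAnti, ← Hom.comm_d, d_formsAnti _ hm rfl hd1 h0]

lemma quasiIso_spanLeft : quasiIso K F.spanLeft := fun n =>
  DGVect.bijective_of_represents _ (F.spanLeft.f n) (fun _ _ => Hmap_represents F.spanLeft)
    (mem_coboundaries_of_tw2Proj F.coneSquare (cone_isAcyclic _) (cone_isAcyclic _))
    (fun ω hω => by
      obtain ⟨σ, hσ, -, h⟩ :=
        F.exists_spanLeft_sub_mem (sub_add_cancel n 1) (sub_add_cancel (n - 1) 1) ω hω
      exact ⟨σ, hσ, h⟩)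

end Morphism

end CartanCalculus

/-! ### The theorem -/

theorem mainTheorem9 {K : Type u} [Field K] [CharZero K] (C₀ C₁ : CartanCalculus K)
    (F : CartanCalculus.Morphism C₀ C₁)
    (h00 : IsInclusion F.f00)
    (h11 : IsInclusion F.f11) (hχ : IsInclusion C₁.χ)
    (hpb : F.targetSquare.IsFiberProduct) :
    ∃ hF : quasiIso K F.spanLeft,
      ∀ (n m k : ℤ) (hm : m + 1 = n) (hk : k + 1 = m),
        ∃ (I₁ : (TW F.f00).H n ≃ₗ[K] (quotRange F.f00).H m)
          (I₂ : (TW2 F.targetSquare).H n ≃ₗ[K] (quotSum F.f11 C₁.χ).H k)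
          (Ψ : (quotRange F.f00).H m →ₗ[K] (quotSum F.f11 C₁.χ).H k),
          (∀ (a : (TW F.f00).H n) (ω : (TW F.f00).X n), (TW F.f00).Represents a ω →
            (quotRange F.f00).Represents (I₁ a)
              (quotRangeMk F.f00 m (twIntegral F.f00 hm ω))) ∧
          (∀ (b : (TW2 F.targetSquare).H n) (ω : (TW2 F.targetSquare).X n),
            (TW2 F.targetSquare).Represents b ω →
            (quotSum F.f11 C₁.χ).Represents (I₂ b)
              (quotSumMk F.f11 C₁.χ k (tw2Integral F.targetSquare hm hk ω))) ∧
          (∀ (x : (quotRange F.f00).H m) (x' : C₁.g00.X m),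
            (quotRange F.f00).Represents x (quotRangeMk F.f00 m x') →
            (quotSum F.f11 C₁.χ).Represents (Ψ x) (quotSumMk F.f11 C₁.χ k (C₁.i hk x'))) ∧
          ∀ a : (TW F.f00).H n, I₂ (hoHmap (F.hofibMap hF) n a) = Ψ (I₁ a) := by
  refine ⟨F.quasiIso_spanLeft, fun n m k hm hk => ⟨twIntegralEquiv F.f00 hm h00,
    tw2IntegralEquiv F.targetSquare hm hk hpb, F.iH hk,
    fun a ω => twIntegralEquiv_represents F.f00 hm h00,
    fun b ω => tw2IntegralEquiv_represents F.targetSquare hm hk hpb,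
    fun x x' => F.iH_represents hk, fun a => ?_⟩⟩
  obtain ⟨ω, hω⟩ := DGVect.exists_represents a
  obtain ⟨σ, hσ, hint, hb⟩ := F.exists_spanLeft_sub_mem hm hk ω hω.1
  obtain ⟨s, hs⟩ : ∃ s, (TW2 F.coneSquare).Represents s σ := ⟨_, hσ, rfl⟩
  -- The class `a` is now the image under the left leg of the class of `σ`, so the morphism of the
  -- span sends it to the class of the right leg applied to `σ`, whose double integral is `c₁(♭∫ω)`.
  obtain rfl : Hmap F.spanLeft n s = a := (Hmap_represents F.spanLeft hs).eq_of_sub_mem hω hb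
  rw [CartanCalculus.Morphism.hofibMap, hoHmap_spanHo]
  have e := tw2IntegralEquiv_represents F.targetSquare hm hk hpb (Hmap_represents F.spanRight hs)
  rw [show tw2Integral F.targetSquare hm hk (F.spanRight.f n σ) = _ from
    tw2Integral_tw2Map F.squareHom hm hk σ, hint] at e
  exact e.eq (F.iH_represents hk (twIntegralEquiv_represents F.f00 hm h00 hω))
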